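/- Conventions. Let $F$ be a compact connected oriented smooth surface, possibly with boundary, and let $\mathsf k$ be a commutative ring with $\mathbb Q\subset \mathsf k$ (i.e. a commutative $\mathbb Q$-algebra). A circle in $F$ is inessential if it bounds an embedded closed disk in $F$, and essential otherwise. Let $\mathfrak C(F)$ be the set of isotopy classes of closed $1$-dimensional submanifolds of the interior of $F$ without inessential components. A diagram is a regular link diagram on $F$ without arc components, and $\mathfrak D(F)$ denotes the set of diagrams. A crossing of a diagram has two smoothings $0$ and $\infty$: if the over-strand is drawn along the diagonal $y=x$ of a positively oriented disk and the under-strand along $y=-x$, then the $0$-smoothing consists of a left and a right arc, and the $\infty$-smoothing of an upper and a lower arc. The Kauffman bracket skein module $\mathfrak K(F)$ is the quotient of the free $\mathsf k[t,t^{-1}]$-module on the isotopy classes of diagrams by the relations $K+tK_0+t^{-1}K_\infty=0$ and $K\amalg U+(t^2+t^{-2})K=0$, where $U$ is a circle bounding a disk in the complement of $K$. The state sum $$\langle D\rangle=\sum_\sigma(-t)^{\zeta(\sigma)-\iota(\sigma)}(-t^2-t^{-2})^{\mu(\sigma)}D(\sigma)$$ (over all assignments $\sigma$ of markers $0,\infty$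 to the crossings of $D$; $\zeta(\sigma)$ and $\iota(\sigma)$ are the numbers of $0$- and $\infty$-markers, $\mu(\sigma)$ is the number of inessential circles and $D(\sigma)\in\mathfrak C(F)$ the collection of essential circles of the resulting smoothing) induces a map $\mathfrak K(F)\to\mathsf k[t,t^{-1}]\mathfrak C(F)$, $[D]\mapsto\langle D\rangle$. Put $t=e^h$ and write $\langle D\rangle=\sum_{k\ge0}\langle D\rangle_kh^k$ with $\langle D\rangle_k\in\mathsf k\mathfrak C(F)$. For $\alpha,\beta\in\mathfrak C(F)$ the star product $\alpha\star\beta=\sum_{k\ge0}\lambda_k(\alpha,\beta)h^k$ is the image under this map of the product of $\alpha$ and $\beta$ in the skein module, that is, of the class of a diagram $\alpha\cdot\beta$ obtained by superimposing representatives of $\alpha$ and $\beta$ in general position, with $\alpha$ over $\beta$; thus $\alpha\star\beta=\langle\alpha\cdot\beta\rangle$. (By isotopy invariance of the bracket this is known not to depend on the chosen diagram; in (2) below it is evaluated on the diagram $\alpha\cdot\beta$ that appears on the right-hand side.) For a polynomial $P=\sum_{i,j}a_{ij}z^iw^j\in\mathsf k[z,w]$ let $\chi(P)$ be the endomorphism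 of the free module $\mathsf k\mathfrak D(F)$ with $$\chi(P)(D)=\sum_{n\ge0}(-1)^n\sum_{T,\sigma}a_{\iota(\sigma),\,n-\iota(\sigma)}\,D_{T,\sigma},$$ where $T$ runs over the $n$-element sets of crossings of $D$, $\sigma$ over the assignments of markers $0,\infty$ to the crossings in $T$, and $D_{T,\sigma}$ is the diagram obtained from $D$ by smoothing the crossings in $T$ according to $\sigma$. For a map $\varphi:\mathbb N\to\mathsf k$ let $\varphi_*:\mathsf k\mathfrak D(F)\to\mathsf k\mathfrak C(F)$ be the linear map $$\varphi_*(D)=(-1)^{c}\sum_\sigma\varphi(\mu(\sigma))D(\sigma),$$ where $c$ is the number of crossings of $D$ and $\sigma$ runs over all states on all crossings. Finally let $\varphi_j(i)\in\mathbb Q$ be the coefficient of $h^{2j}$ in $(-t^2-t^{-2})^i$, $t=e^h$. Statement. There are polynomials $P_k\in\mathbb Q[z,w]$, $k\ge0$, depending only on $k$ (not on $F$, $\mathsf k$ or any diagram), where $P_k$ has degree $k$, is not homogeneous for $k>1$, and has homogeneous component of degree $k$ equal to $w^k-zw^{k-1}+z^2w^{k-2}-\dots+(-1)^kz^k$, such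 that for all $F$ and $\mathsf k$ as above: (1) for every diagram $D$ on $F$ and every $k\ge0$, $\langle D\rangle_k=\sum_{j=0}^{\lfloor k/2\rfloor}(\varphi_j)_*\chi(P_{k-2j})(D)$; (2) if $\alpha,\beta$ are simple essential loops on $F$ and $\alpha\cdot\beta$ is any diagram of $\alpha$ over $\beta$, then for all $k\ge0$ $$\lambda_k(\alpha,\beta)=\sum_{j=0}^{\lfloor k/2\rfloor}(\varphi_j)_*\chi(P_{k-2j})(\alpha\cdot\beta).$$ -/

import Mathlib

open scoped Manifold ContDiff LaurentPolynomial

universe u v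

set_option linter.unusedSectionVars false

noncomputable section

namespace KauffmanStar

open Set

/-! ### Surfaces, curves and isotopies -/

/-- The Euclidean plane, with coordinates `z 0`, `z 1`. -/
abbrev Plane := EuclideanSpace ℝ (Fin 2)

/-- A smooth surface, possibly with boundary, is *oriented* when all coordinate changes of its
atlas have positive Jacobian determinant (the atlas then determines the orientation). -/
class IsOriented (F : Type u) [TopologicalSpace F] [ChartedSpace (EuclideanHalfSpace 2) F] :
    Prop where
  det_pos : ∀ e ∈ atlas (EuclideanHalfSpace 2) F, ∀ e' ∈ atlas (EuclideanHalfSpace 2) F,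
    ∀ x ∈ e.source ∩ e'.source,
      0 < (fderivWithin ℝ (e'.extend (𝓡∂ 2) ∘ (e.extend (𝓡∂ 2)).symm) (range (𝓡∂ 2))
        (e.extend (𝓡∂ 2) x)).det

section Surface

variable (F : Type u) [TopologicalSpace F] [ChartedSpace (EuclideanHalfSpace 2) F]

/-- A smooth chart of the interior of `F`: a diffeomorphism from an open subset of the interior
onto an open subset of the plane. -/
structure PlaneChart extends OpenPartialHomeomorph F Plane where
  contMDiffOn_toFun : ContMDiffOn (𝓡∂ 2) (𝓡 2) ∞ toFun source
  contMDiffOn_invFun : ContMDiffOn (𝓡 2) (𝓡∂ 2) ∞ invFun target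
  source_interior : source ⊆ (𝓡∂ 2).interior F

/-- A smooth ambient isotopy of `F` (a level preserving diffeomorphism of `ℝ × F`), starting at
the identity and fixing the boundary pointwise. -/
structure AmbientIsotopy where
  toFun : ℝ → F → F
  invFun : ℝ → F → F
  contMDiff_toFun :
    ContMDiff (𝓘(ℝ, ℝ).prod (𝓡∂ 2)) (𝓡∂ 2) ∞ (fun p : ℝ × F => toFun p.1 p.2)
  contMDiff_invFun :
    ContMDiff (𝓘(ℝ, ℝ).prod (𝓡∂ 2)) (𝓡∂ 2) ∞ (fun p : ℝ × F => invFun p.1 p.2)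
  left_inv : ∀ t x, invFun t (toFun t x) = x
  right_inv : ∀ t x, toFun t (invFun t x) = x
  at_zero : ∀ x, toFun 0 x = x
  boundary_fixed : ∀ t, ∀ x ∈ (𝓡∂ 2).boundary F, toFun t x = x

variable {F}

/-- `e` is an orientation preserving chart. -/
def PlaneChart.IsPositive (e : PlaneChart F) : Prop :=
  ∀ e₀ ∈ atlas (EuclideanHalfSpace 2) F, ∀ x ∈ e₀.source ∩ e.source,
    0 < (fderivWithin ℝ (e.toFun ∘ (e₀.extend (𝓡∂ 2)).symm) (range (𝓡∂ 2))
      (e₀.extend (𝓡∂ 2) x)).det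

/-- Near `p`, the set `S` is a smooth curve in the interior of `F`: there is a chart around `p`
in which `S` is a straight line. -/
def IsFlatAt (S : Set F) (p : F) : Prop :=
  ∃ e : PlaneChart F, p ∈ e.source ∧ ∀ x ∈ e.source, x ∈ S ↔ e.toFun x 1 = 0

/-- `S` is a closed `1`-dimensional submanifold of the interior of the compact surface `F`. -/
structure IsCurve (S : Set F) : Prop where
  isClosed : IsClosed S
  flat : ∀ p ∈ S, IsFlatAt S p

/-- `C` is the boundary circle of a closed disk embedded in `F`. -/
def BoundsDisk (C : Set F) : Prop :=
  ∃ f : Plane → F, ContinuousOn f (Metric.closedBall 0 1) ∧ InjOn f (Metric.closedBall 0 1) ∧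
    f '' Metric.sphere 0 1 = C

/-- The union of the essential components of `S`. -/
def essentialPart (S : Set F) : Set F :=
  {x | x ∈ S ∧ ¬ BoundsDisk (connectedComponentIn S x)}

/-- The inessential components of `S`. -/
def trivialComponents (S : Set F) : Set (Set F) :=
  {C | (∃ x ∈ S, connectedComponentIn S x = C) ∧ BoundsDisk C}

/-- The number of inessential components of `S`. -/
def numTrivial (S : Set F) : ℕ := (trivialComponents S).ncard

variable (F) in
/-- A closed `1`-dimensional submanifold of the interior of `F`, without inessential
components. -/
structure CurveSystem where
  carrier : Set F
  isCurve : IsCurve carrier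
  essential : ∀ x ∈ carrier, ¬ BoundsDisk (connectedComponentIn carrier x)

section CurveLemmas

theorem IsFlatAt.exists_nhds {S : Set F} {p : F} (h : IsFlatAt S p) (hp : p ∈ S) :
    ∃ U, IsOpen U ∧ p ∈ U ∧ S ∩ U ⊆ connectedComponentIn S p := by
  obtain ⟨e, hpe, he⟩ := h
  have hpt : e.toFun p ∈ e.target := e.map_source hpe
  obtain ⟨r, hr, hball⟩ := Metric.isOpen_iff.1 e.open_target _ hpt
  set B := Metric.ball (e.toFun p) r with hB
  have hL : Convex ℝ {z : Plane | z 1 = 0} := by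
    intro x hx y hy a b _ _ _
    simp only [mem_ofPred_eq] at hx hy
    simp [hx, hy]
  have hconv : Convex ℝ (B ∩ {z : Plane | z 1 = 0}) := (convex_ball _ _).inter hL
  have hpre : IsPreconnected (e.invFun '' (B ∩ {z : Plane | z 1 = 0})) :=
    hconv.isPreconnected.image _
      (e.continuousOn_invFun.mono fun z hz => hball hz.1)
  refine ⟨e.source ∩ e.toFun ⁻¹' B,
    e.toOpenPartialHomeomorph.isOpen_inter_preimage Metric.isOpen_ball,
    ⟨hpe, Metric.mem_ball_self hr⟩, ?_⟩
  have hsub : e.invFun '' (B ∩ {z : Plane | z 1 = 0}) ⊆ S := by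
    rintro _ ⟨z, ⟨hzB, hz⟩, rfl⟩
    refine (he _ (e.map_target (hball hzB))).2 ?_
    have h2 : e.toFun (e.invFun z) = z := e.right_inv' (hball hzB)
    exact (congrArg (fun w : Plane => w 1) h2).trans hz
  have hpin : p ∈ e.invFun '' (B ∩ {z : Plane | z 1 = 0}) :=
    ⟨e.toFun p, ⟨Metric.mem_ball_self hr, (he p hpe).1 hp⟩, e.left_inv' hpe⟩
  refine Subset.trans ?_ (hpre.subset_connectedComponentIn hpin hsub)
  rintro x ⟨hxS, hxe, hxB⟩
  exact ⟨e.toFun x, ⟨hxB, (he x hxe).1 hxS⟩, e.left_inv' hxe⟩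

theorem IsCurve.finite_trivialComponents [CompactSpace F] {S : Set F} (h : IsCurve S) :
    (trivialComponents S).Finite := by
  have hc : IsCompact S := h.isClosed.isCompact
  choose! U hUo hUp hUs using fun p (hp : p ∈ S) => (h.flat p hp).exists_nhds hp
  obtain ⟨t, ht, hcov⟩ := hc.elim_nhds_subcover U fun p hp => (hUo p hp).mem_nhds (hUp p hp)
  refine (t.finite_toSet.image (connectedComponentIn S)).subset ?_
  rintro C ⟨⟨x, hx, rfl⟩, -⟩
  obtain ⟨p, hp, hxp⟩ := mem_iUnion₂.1 (hcov hx)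
  exact ⟨p, hp, connectedComponentIn_eq (hUs p (ht p hp) ⟨hx, hxp⟩)⟩

/-- Restriction of a chart to a smaller open set. -/
def PlaneChart.restrict (e : PlaneChart F) (U : Set F) (hU : IsOpen U) : PlaneChart F where
  toOpenPartialHomeomorph := e.toOpenPartialHomeomorph.restrOpen U hU
  contMDiffOn_toFun := e.contMDiffOn_toFun.mono (by
    rw [OpenPartialHomeomorph.restrOpen_source]; exact inter_subset_left)
  contMDiffOn_invFun := e.contMDiffOn_invFun.mono (by
    intro z hz; exact hz.1)
  source_interior := by
    rw [OpenPartialHomeomorph.restrOpen_source]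
    exact inter_subset_left.trans e.source_interior

theorem IsFlatAt.congr {S S' U : Set F} {p : F} (h : IsFlatAt S p) (hU : IsOpen U) (hp : p ∈ U)
    (hS : ∀ x ∈ U, x ∈ S ↔ x ∈ S') : IsFlatAt S' p := by
  obtain ⟨e, hpe, he⟩ := h
  refine ⟨e.restrict U hU, ⟨hpe, hp⟩, ?_⟩
  rintro x ⟨hxe, hxU⟩
  rw [← hS x hxU]
  exact he x hxe

theorem IsCurve.essentialPart {S : Set F} (h : IsCurve S) : IsCurve (essentialPart S) := by
  choose! U hUo hUp hUs using fun p (hp : p ∈ S) => (h.flat p hp).exists_nhds hp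
  have key : ∀ p ∈ S, ∀ x ∈ U p, x ∈ S →
      connectedComponentIn S p = connectedComponentIn S x := fun p hp x hx hxS =>
    connectedComponentIn_eq (hUs p hp ⟨hxS, hx⟩)
  refine ⟨?_, ?_⟩
  · have : KauffmanStar.essentialPart S =
        S ∩ (⋃ p ∈ {p | p ∈ S ∧ BoundsDisk (connectedComponentIn S p)}, U p)ᶜ := by
      ext x
      simp only [KauffmanStar.essentialPart, mem_ofPred_eq, mem_inter_iff, mem_compl_iff,
        mem_iUnion, not_exists]
      refine ⟨fun hx => ⟨hx.1, fun p hp hxp => hx.2 ?_⟩, fun hx => ⟨hx.1, fun hb => ?_⟩⟩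
      · rw [← key p hp.1 x hxp hx.1]; exact hp.2
      · exact hx.2 x ⟨hx.1, hb⟩ (hUp x hx.1)
    rw [this]
    exact h.isClosed.inter (isOpen_biUnion fun p hp => hUo p hp.1).isClosed_compl
  · rintro p ⟨hp, hpe⟩
    refine (h.flat p hp).congr (hUo p hp) (hUp p hp) fun x hx => ?_
    refine ⟨fun hxS => ⟨hxS, ?_⟩, fun hxS => hxS.1⟩
    rw [← key p hp x hx hxS]; exact hpe

theorem connectedComponentIn_essentialPart {S : Set F} {x : F} (hx : x ∈ essentialPart S) :
    connectedComponentIn (essentialPart S) x = connectedComponentIn S x := by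
  refine Subset.antisymm (connectedComponentIn_mono x fun y hy => hy.1) ?_
  refine isPreconnected_connectedComponentIn.subset_connectedComponentIn
    (mem_connectedComponentIn hx.1) fun y hy => ⟨connectedComponentIn_subset _ _ hy, ?_⟩
  rw [← connectedComponentIn_eq hy]
  exact hx.2

/-- The curve system formed by the essential components of a closed `1`-submanifold. -/
def IsCurve.essentialSystem {S : Set F} (h : IsCurve S) : CurveSystem F where
  carrier := KauffmanStar.essentialPart S
  isCurve := h.essentialPart
  essential x hx := by
    rw [connectedComponentIn_essentialPart hx]; exact hx.2

/-- The identity isotopy. -/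
def AmbientIsotopy.refl : AmbientIsotopy F where
  toFun _ x := x
  invFun _ x := x
  contMDiff_toFun := contMDiff_snd
  contMDiff_invFun := contMDiff_snd
  left_inv _ _ := rfl
  right_inv _ _ := rfl
  at_zero _ := rfl
  boundary_fixed _ _ _ := rfl

/-- The inverse isotopy. -/
def AmbientIsotopy.symm (H : AmbientIsotopy F) : AmbientIsotopy F where
  toFun := H.invFun
  invFun := H.toFun
  contMDiff_toFun := H.contMDiff_invFun
  contMDiff_invFun := H.contMDiff_toFun
  left_inv := H.right_inv
  right_inv := H.left_inv
  at_zero x := by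
    have := H.left_inv 0 x
    rwa [H.at_zero] at this
  boundary_fixed t x hx := by
    have := H.left_inv t x
    rwa [H.boundary_fixed t x hx] at this

/-- Levelwise composition of isotopies. -/
def AmbientIsotopy.trans (H K : AmbientIsotopy F) : AmbientIsotopy F where
  toFun t x := K.toFun t (H.toFun t x)
  invFun t x := H.invFun t (K.invFun t x)
  contMDiff_toFun :=
    K.contMDiff_toFun.comp (contMDiff_fst.prodMk H.contMDiff_toFun)
  contMDiff_invFun :=
    H.contMDiff_invFun.comp (contMDiff_fst.prodMk K.contMDiff_invFun)
  left_inv t x := by rw [K.left_inv, H.left_inv]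
  right_inv t x := by rw [H.right_inv, K.right_inv]
  at_zero x := by rw [H.at_zero, K.at_zero]
  boundary_fixed t x hx := by rw [H.boundary_fixed t x hx, K.boundary_fixed t x hx]

/-- The end map of an isotopy. -/
def AmbientIsotopy.endHomeo (H : AmbientIsotopy F) : F ≃ₜ F where
  toFun := H.toFun 1
  invFun := H.invFun 1
  left_inv := H.left_inv 1
  right_inv := H.right_inv 1
  continuous_toFun := H.contMDiff_toFun.continuous.comp (Continuous.prodMk_right 1)
  continuous_invFun := H.contMDiff_invFun.continuous.comp (Continuous.prodMk_right 1)

end CurveLemmas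

variable (F) in
/-- Two curve systems are isotopic when an ambient isotopy carries one to the other. -/
def curveSetoid : Setoid (CurveSystem F) where
  r S S' := ∃ H : AmbientIsotopy F, H.endHomeo '' S.carrier = S'.carrier
  iseqv :=
    { refl := fun S => ⟨AmbientIsotopy.refl, image_id _⟩
      symm := by
        rintro S S' ⟨H, h⟩
        refine ⟨H.symm, ?_⟩
        rw [← h]
        exact H.endHomeo.symm_image_image _
      trans := by
        rintro S S' S'' ⟨H, h⟩ ⟨K, k⟩
        refine ⟨H.trans K, ?_⟩
        rw [← k, ← h, image_image]
        rfl }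

variable (F) in
/-- `ℭ(F)`: isotopy classes of closed `1`-submanifolds of the interior of `F` without
inessential components. -/
def CurveClass := Quotient (curveSetoid F)

/-- The isotopy class of a curve system. -/
def CurveSystem.toClass (S : CurveSystem F) : CurveClass F := Quotient.mk (curveSetoid F) S

/-- The class of a single (simple, essential) loop: it has a connected representative. -/
def CurveClass.IsLoop (α : CurveClass F) : Prop :=
  ∃ S : CurveSystem F, S.toClass = α ∧ IsConnected S.carrier

/-! ### Smoothing a crossing in the plane

The crossing is the pair of diagonals `(z 0)² = (z 1)²`, with over-strand `z 0 = z 1`. -/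

/-- A smooth positive function with `roundSq y = y ^ 2` for `1 ≤ y ^ 2`. -/
def roundSq (y : ℝ) : ℝ := 1 + Real.smoothTransition (y ^ 2) * (y ^ 2 - 1)

/-- The `0`-smoothing `)(` of the crossing: the two arcs `z 0 = ± √(roundSq (z 1))`. -/
def zeroSmoothing : Set Plane := {z | (z 0) ^ 2 = roundSq (z 1)}

/-- The `∞`-smoothing of the crossing: the two arcs `z 1 = ± √(roundSq (z 0))`. -/
def inftySmoothing : Set Plane := {z | (z 1) ^ 2 = roundSq (z 0)}

open Classical in
/-- The smoothing of the crossing with marker `∞` if `m` holds, and marker `0` otherwise. -/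
def markerSmoothing (m : Prop) : Set Plane := if m then inftySmoothing else zeroSmoothing

theorem roundSq_of_one_le {y : ℝ} (h : 1 ≤ y ^ 2) : roundSq y = y ^ 2 := by
  rw [roundSq, Real.smoothTransition.one_of_one_le h]; ring

theorem roundSq_le_one {y : ℝ} (h : y ^ 2 ≤ 1) : roundSq y ≤ 1 := by
  have := Real.smoothTransition.nonneg (y ^ 2)
  rw [roundSq]; nlinarith

theorem roundSq_pos (y : ℝ) : 0 < roundSq y := by
  rcases eq_or_ne y 0 with rfl | hy
  · simp [roundSq, Real.smoothTransition.zero]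
  · have h0 : 0 < y ^ 2 := by positivity
    have h1 := Real.smoothTransition.nonneg (y ^ 2)
    have h2 := Real.smoothTransition.le_one (y ^ 2)
    rw [roundSq]
    rcases le_total 1 (y ^ 2) with h | h <;> nlinarith

theorem contDiff_roundSq : ContDiff ℝ ∞ roundSq := by
  unfold roundSq
  have h : ContDiff ℝ ∞ (fun y : ℝ => Real.smoothTransition (y ^ 2)) :=
    Real.smoothTransition.contDiff.comp (contDiff_id.pow 2)
  exact contDiff_const.add (h.mul ((contDiff_id.pow 2).sub contDiff_const))

theorem contDiff_sqrt_roundSq : ContDiff ℝ ∞ fun y => √(roundSq y) :=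
  contDiff_roundSq.sqrt fun y => (roundSq_pos y).ne'

theorem isClosed_markerSmoothing (m : Prop) : IsClosed (markerSmoothing m) := by
  have h := contDiff_roundSq.continuous
  unfold markerSmoothing
  split_ifs
  · exact isClosed_eq (by fun_prop) (by fun_prop)
  · exact isClosed_eq (by fun_prop) (by fun_prop)

theorem mem_markerSmoothing_of_not_mem {m : Prop} {z : Plane}
    (hz : z ∉ Metric.closedBall (0 : Plane) 2) :
    z ∈ markerSmoothing m ↔ (z 0) ^ 2 = (z 1) ^ 2 := by
  have hn : 4 < (z 0) ^ 2 + (z 1) ^ 2 := by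
    rw [mem_closedBall_zero_iff, not_le] at hz
    have h := EuclideanSpace.norm_sq_eq z
    simp only [Fin.sum_univ_two, Real.norm_eq_abs, sq_abs] at h
    nlinarith
  have aux : ∀ a b : ℝ, 4 < a ^ 2 + b ^ 2 → (a ^ 2 = roundSq b ↔ a ^ 2 = b ^ 2) := by
    intro a b hab
    rcases le_total 1 (b ^ 2) with h | h
    · rw [roundSq_of_one_le h]
    · have := roundSq_le_one h
      constructor <;> intro h' <;> linarith
  unfold markerSmoothing
  split_ifs
  · exact (aux _ _ (by linarith)).trans eq_comm
  · exact aux _ _ hn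

/-- The shear straightening the graph `z 0 = f (z 1)`. -/
def shearZero (f : ℝ → ℝ) (hf : Continuous f) : Plane ≃ₜ Plane where
  toFun z := !₂[z 1, z 0 - f (z 1)]
  invFun z := !₂[z 1 + f (z 0), z 0]
  left_inv z := by ext i; fin_cases i <;> simp
  right_inv z := by ext i; fin_cases i <;> simp
  continuous_toFun := by fun_prop
  continuous_invFun := by fun_prop

/-- The shear straightening the graph `z 1 = f (z 0)`. -/
def shearOne (f : ℝ → ℝ) (hf : Continuous f) : Plane ≃ₜ Plane where
  toFun z := !₂[z 0, z 1 - f (z 0)]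
  invFun z := !₂[z 0, z 1 + f (z 0)]
  left_inv z := by ext i; fin_cases i <;> simp
  right_inv z := by ext i; fin_cases i <;> simp
  continuous_toFun := by fun_prop
  continuous_invFun := by fun_prop

theorem contDiff_coord (i : Fin 2) : ContDiff ℝ ∞ fun z : Plane => z i :=
  (contDiff_euclidean (f := fun z : Plane => z)).1 contDiff_id i

theorem contDiff_shearZero {f : ℝ → ℝ} (hf : ContDiff ℝ ∞ f) :
    ContDiff ℝ ∞ (shearZero f hf.continuous) := by
  refine contDiff_euclidean.2 fun i => ?_
  fin_cases i
  · exact contDiff_coord 1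
  · exact (contDiff_coord 0).sub (hf.comp (contDiff_coord 1))

theorem contDiff_shearZero_symm {f : ℝ → ℝ} (hf : ContDiff ℝ ∞ f) :
    ContDiff ℝ ∞ (shearZero f hf.continuous).symm := by
  refine contDiff_euclidean.2 fun i => ?_
  fin_cases i
  · exact (contDiff_coord 1).add (hf.comp (contDiff_coord 0))
  · exact contDiff_coord 0

theorem contDiff_shearOne {f : ℝ → ℝ} (hf : ContDiff ℝ ∞ f) :
    ContDiff ℝ ∞ (shearOne f hf.continuous) := by
  refine contDiff_euclidean.2 fun i => ?_
  fin_cases i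
  · exact contDiff_coord 0
  · exact (contDiff_coord 1).sub (hf.comp (contDiff_coord 0))

theorem contDiff_shearOne_symm {f : ℝ → ℝ} (hf : ContDiff ℝ ∞ f) :
    ContDiff ℝ ∞ (shearOne f hf.continuous).symm := by
  refine contDiff_euclidean.2 fun i => ?_
  fin_cases i
  · exact contDiff_coord 0
  · exact (contDiff_coord 1).add (hf.comp (contDiff_coord 0))

/-- A smoothed crossing is locally straightened by a diffeomorphism of the plane. -/
theorem exists_straighten (m : Prop) (z : Plane) (hz : z ∈ markerSmoothing m) :
    ∃ (U : Set Plane) (φ : Plane ≃ₜ Plane), IsOpen U ∧ z ∈ U ∧ ContDiff ℝ ∞ φ ∧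
      ContDiff ℝ ∞ φ.symm ∧ ∀ w ∈ U, w ∈ markerSmoothing m ↔ φ w 1 = 0 := by
  have hs := contDiff_sqrt_roundSq
  have key : ∀ s : ℝ, s ^ 2 = 1 → ∀ a b : ℝ, 0 < s * a →
      (a ^ 2 = roundSq b ↔ a - s * √(roundSq b) = 0) := by
    intro s hs a b hab
    have h1 := Real.sq_sqrt (roundSq_pos b).le
    have h2 := Real.sqrt_pos.2 (roundSq_pos b)
    constructor
    · intro h
      have h3 : (s * a) ^ 2 = √(roundSq b) ^ 2 := by rw [h1, mul_pow, hs, one_mul, h]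
      have h4 : s * a = √(roundSq b) := (pow_left_inj₀ hab.le h2.le two_ne_zero).1 h3
      rw [← h4, ← mul_assoc, ← sq, hs]; ring
    · intro h
      have : a = s * √(roundSq b) := by linarith
      rw [this, mul_pow, hs, h1, one_mul]
  have sgn : ∀ a b : ℝ, a ^ 2 = roundSq b → ∃ s : ℝ, s ^ 2 = 1 ∧ 0 < s * a := by
    intro a b h
    have ha : a ≠ 0 := by
      rintro rfl
      have := roundSq_pos b
      rw [← h] at this; norm_num at this
    rcases ha.lt_or_gt with h | h
    · exact ⟨-1, by norm_num, by linarith⟩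
    · exact ⟨1, by norm_num, by linarith⟩
  unfold markerSmoothing at hz ⊢
  split_ifs at hz ⊢
  · obtain ⟨s, hs1, hs2⟩ := sgn _ _ hz
    have hf : ContDiff ℝ ∞ fun y => s * √(roundSq y) := contDiff_const.mul hs
    refine ⟨{w | 0 < s * w 1}, shearOne _ hf.continuous,
      isOpen_lt continuous_const (by fun_prop), hs2, ?_, ?_, ?_⟩
    · exact contDiff_shearOne hf
    · exact contDiff_shearOne_symm hf
    · intro w hw
      simpa [shearOne, inftySmoothing] using key s hs1 (w 1) (w 0) hw
  · obtain ⟨s, hs1, hs2⟩ := sgn _ _ hz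
    have hf : ContDiff ℝ ∞ fun y => s * √(roundSq y) := contDiff_const.mul hs
    refine ⟨{w | 0 < s * w 0}, shearZero _ hf.continuous,
      isOpen_lt continuous_const (by fun_prop), hs2, ?_, ?_, ?_⟩
    · exact contDiff_shearZero hf
    · exact contDiff_shearZero_symm hf
    · intro w hw
      simpa [shearZero, zeroSmoothing] using key s hs1 (w 0) (w 1) hw

/-- Postcomposition of a chart with a diffeomorphism of the plane. -/
def PlaneChart.postcomp (e : PlaneChart F) (φ : Plane ≃ₜ Plane) (h : ContDiff ℝ ∞ φ)
    (h' : ContDiff ℝ ∞ φ.symm) : PlaneChart F where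
  toOpenPartialHomeomorph := e.toOpenPartialHomeomorph.transHomeomorph φ
  contMDiffOn_toFun := h.contMDiff.comp_contMDiffOn e.contMDiffOn_toFun
  contMDiffOn_invFun :=
    e.contMDiffOn_invFun.comp h'.contMDiff.contMDiffOn fun _ hz => hz
  source_interior := e.source_interior

theorem PlaneChart.isFlatAt_markerSmoothing (e : PlaneChart F) {S : Set F} {p : F} (m : Prop)
    (hp : p ∈ e.source) (hpS : p ∈ S)
    (hS : ∀ x ∈ e.source, x ∈ S ↔ e.toFun x ∈ markerSmoothing m) : IsFlatAt S p := by
  obtain ⟨U, φ, hU, hzU, h1, h2, h3⟩ := exists_straighten m _ ((hS p hp).1 hpS)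
  refine ⟨(e.postcomp φ h1 h2).restrict (e.source ∩ e.toFun ⁻¹' U)
    (e.toOpenPartialHomeomorph.isOpen_inter_preimage hU), ⟨hp, hp, hzU⟩, ?_⟩
  rintro x ⟨-, hx, hxU⟩
  exact (hS x hx).trans (h3 _ hxU)

/-! ### Diagrams and their smoothings -/

variable (F) in
/-- A regular link diagram on `F`, without arc components: a closed subset `carrier` of the
interior of `F` which is a smooth curve away from finitely many crossings. Every crossing has a
disk neighbourhood, parametrized by an orientation preserving chart onto the plane, which carries
the diagram to the two diagonals, the over-strand going to `z 0 = z 1`; the neighbourhoods of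
distinct crossings are disjoint. -/
structure Diagram where
  carrier : Set F
  isClosed : IsClosed carrier
  crossings : Finset F
  chart : ∀ c ∈ crossings, PlaneChart F
  chart_pos : ∀ c hc, (chart c hc).IsPositive
  chart_target : ∀ c hc, (chart c hc).target = univ
  mem_chart : ∀ c hc, c ∈ (chart c hc).source
  chart_center : ∀ c hc, (chart c hc).toFun c = 0
  chart_carrier : ∀ c hc, ∀ x ∈ (chart c hc).source,
    x ∈ carrier ↔ ((chart c hc).toFun x 0) ^ 2 = ((chart c hc).toFun x 1) ^ 2
  chart_disjoint : ∀ c hc c' hc', c ≠ c' →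
    Disjoint (chart c hc).source (chart c' hc').source
  flat : ∀ p ∈ carrier, p ∉ crossings → IsFlatAt carrier p

namespace Diagram

/-- The projection obtained from `D` by smoothing the crossings in `T`: the crossings in `A` get
the marker `∞` and the others the marker `0`. -/
def smoothSet (D : Diagram F) (T A : Finset F) : Set F :=
  {x | x ∈ D.carrier ∧ ∀ c hc, c ∈ T → x ∉ (D.chart c hc).source} ∪
    {x | ∃ c hc, c ∈ T ∧ x ∈ (D.chart c hc).source ∧
      (D.chart c hc).toFun x ∈ markerSmoothing (c ∈ A)}

section SmoothLemmas

variable (D : Diagram F) (T A : Finset F)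

theorem mem_smoothSet_iff_marker {c : F} (hc : c ∈ D.crossings) (hT : c ∈ T) {x : F}
    (hx : x ∈ (D.chart c hc).source) :
    x ∈ D.smoothSet T A ↔ (D.chart c hc).toFun x ∈ markerSmoothing (c ∈ A) := by
  constructor
  · rintro (⟨-, h⟩ | ⟨c', hc', -, hx', h⟩)
    · exact absurd hx (h c hc hT)
    · rcases eq_or_ne c c' with rfl | hne
      · exact h
      · exact absurd hx' (disjoint_left.1 (D.chart_disjoint c hc c' hc' hne) hx)
  · exact fun h => Or.inr ⟨c, hc, hT, hx, h⟩

theorem mem_smoothSet_iff_carrier {x : F}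
    (hx : ∀ c hc, c ∈ T → x ∉ (D.chart c hc).source) :
    x ∈ D.smoothSet T A ↔ x ∈ D.carrier := by
  constructor
  · rintro (⟨h, -⟩ | ⟨c, hc, hT, hx', -⟩)
    · exact h
    · exact absurd hx' (hx c hc hT)
  · exact fun h => Or.inl ⟨h, hx⟩

theorem mem_smoothSet_iff_carrier' {c : F} (hc : c ∈ D.crossings) (hT : c ∉ T) {x : F}
    (hx : x ∈ (D.chart c hc).source) : x ∈ D.smoothSet T A ↔ x ∈ D.carrier := by
  refine D.mem_smoothSet_iff_carrier T A fun c' hc' hT' hx' => ?_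
  have hne : c ≠ c' := by rintro rfl; exact hT hT'
  exact disjoint_left.1 (D.chart_disjoint c hc c' hc' hne) hx hx'

/-- The union of the closed disks in which the smoothing of the crossings in `T` happens. -/
def core : Set F :=
  ⋃ c : D.crossings, ⋃ _ : (c : F) ∈ T,
    (D.chart c c.2).invFun '' Metric.closedBall (0 : Plane) 2

theorem isClosed_core [T2Space F] : IsClosed (D.core T) := by
  refine isClosed_iUnion_of_finite fun c => isClosed_iUnion_of_finite fun _ => ?_
  refine ((isCompact_closedBall (0 : Plane) 2).image_of_continuousOn ?_).isClosed
  exact (D.chart c c.2).continuousOn_invFun.mono (by rw [D.chart_target]; exact subset_univ _)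

theorem mem_smoothSet_of_not_mem_core {x : F} (hx : x ∉ D.core T) :
    x ∈ D.carrier ↔ x ∈ D.smoothSet T A := by
  by_cases h : ∃ c hc, c ∈ T ∧ x ∈ (D.chart c hc).source
  · obtain ⟨c, hc, hT, hxc⟩ := h
    rw [D.mem_smoothSet_iff_marker T A hc hT hxc, D.chart_carrier c hc x hxc,
      mem_markerSmoothing_of_not_mem]
    intro hz
    refine hx (mem_iUnion.2 ⟨⟨c, hc⟩, mem_iUnion.2 ⟨hT, _, hz, ?_⟩⟩)
    exact (D.chart c hc).left_inv' hxc
  · push Not at h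
    exact (D.mem_smoothSet_iff_carrier T A h).symm

theorem isClosed_smoothSet [T2Space F] : IsClosed (D.smoothSet T A) := by
  rw [← isOpen_compl_iff, isOpen_iff_forall_mem_open]
  intro x hx
  by_cases h : ∃ c hc, c ∈ T ∧ x ∈ (D.chart c hc).source
  · obtain ⟨c, hc, hT, hxc⟩ := h
    refine ⟨(D.chart c hc).source ∩ (D.chart c hc).toFun ⁻¹' (markerSmoothing (c ∈ A))ᶜ, ?_,
      (D.chart c hc).toOpenPartialHomeomorph.isOpen_inter_preimage
        (isClosed_markerSmoothing _).isOpen_compl, hxc, ?_⟩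
    · rintro y ⟨hy, hy'⟩ hyS
      exact hy' ((D.mem_smoothSet_iff_marker T A hc hT hy).1 hyS)
    · intro h'
      exact hx ((D.mem_smoothSet_iff_marker T A hc hT hxc).2 h')
  · push Not at h
    refine ⟨(D.core T)ᶜ ∩ D.carrierᶜ, ?_,
      (D.isClosed_core T).isOpen_compl.inter D.isClosed.isOpen_compl, ?_, ?_⟩
    · rintro y ⟨hy, hy'⟩ hyS
      exact hy' ((D.mem_smoothSet_of_not_mem_core T A hy).2 hyS)
    · intro hxc
      obtain ⟨c, hxc⟩ := mem_iUnion.1 hxc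
      obtain ⟨hT, z, -, rfl⟩ := mem_iUnion.1 hxc
      exact h c c.2 hT ((D.chart c c.2).map_target' (by rw [D.chart_target]; trivial))
    · exact fun h' => hx ((D.mem_smoothSet_iff_carrier T A h).2 h')

theorem not_mem_core {x : F} (h : ∀ c hc, c ∈ T → x ∉ (D.chart c hc).source) :
    x ∉ D.core T := by
  intro hxc
  obtain ⟨c, hxc⟩ := mem_iUnion.1 hxc
  obtain ⟨hT, z, -, rfl⟩ := mem_iUnion.1 hxc
  exact h c c.2 hT ((D.chart c c.2).map_target' (by rw [D.chart_target]; trivial))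

theorem flat_smoothSet [T2Space F] {p : F} (hp : p ∈ D.smoothSet T A)
    (hpc : p ∈ D.crossings → p ∈ T) : IsFlatAt (D.smoothSet T A) p := by
  by_cases h : ∃ c hc, c ∈ T ∧ p ∈ (D.chart c hc).source
  · obtain ⟨c, hc, hT, hxc⟩ := h
    exact (D.chart c hc).isFlatAt_markerSmoothing (c ∈ A) hxc hp fun x hx =>
      D.mem_smoothSet_iff_marker T A hc hT hx
  · push Not at h
    refine (D.flat p ((D.mem_smoothSet_iff_carrier T A h).1 hp) fun hpC => ?_).congr
      (D.isClosed_core T).isOpen_compl (D.not_mem_core T h)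
      fun x hx => D.mem_smoothSet_of_not_mem_core T A hx
    exact h p hpC (hpc hpC) (D.mem_chart p hpC)

end SmoothLemmas

/-- Two diagrams are isotopic when an ambient isotopy carries one to the other, together with the
crossings and their parametrized disk neighbourhoods. -/
def Isotopic (D D' : Diagram F) : Prop :=
  ∃ H : AmbientIsotopy F,
    (∀ x, H.endHomeo x ∈ D'.carrier ↔ x ∈ D.carrier) ∧
    (∀ c, H.endHomeo c ∈ D'.crossings ↔ c ∈ D.crossings) ∧
    ∀ c hc hc', ∀ x,
      (H.endHomeo x ∈ (D'.chart (H.endHomeo c) hc').source ↔ x ∈ (D.chart c hc).source) ∧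
      (x ∈ (D.chart c hc).source →
        (D'.chart (H.endHomeo c) hc').toFun (H.endHomeo x) = (D.chart c hc).toFun x)

/-- `D'` is the disjoint union of `D` and a circle bounding a disk in the complement of `D`. -/
def IsUnionTrivial (D D' : Diagram F) : Prop :=
  ∃ f : Plane → F, ContinuousOn f (Metric.closedBall 0 1) ∧ InjOn f (Metric.closedBall 0 1) ∧
    Disjoint D.carrier (f '' Metric.closedBall 0 1) ∧
    D'.carrier = D.carrier ∪ f '' Metric.sphere 0 1 ∧
    D'.crossings = D.crossings ∧ ∀ c hc hc', D'.chart c hc' = D.chart c hc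

variable [T2Space F]

open Classical in
/-- The diagram obtained from `D` by smoothing the crossings in `T`, those in `A` with the marker
`∞` and the others with the marker `0`. -/
def smooth (D : Diagram F) (T A : Finset F) : Diagram F where
  carrier := D.smoothSet T A
  isClosed := D.isClosed_smoothSet T A
  crossings := D.crossings \ T
  chart c hc := D.chart c (Finset.mem_sdiff.1 hc).1
  chart_pos c _ := D.chart_pos c _
  chart_target c _ := D.chart_target c _
  mem_chart c _ := D.mem_chart c _
  chart_center c _ := D.chart_center c _
  chart_carrier c hc x hx := by
    rw [D.mem_smoothSet_iff_carrier' T A _ (Finset.mem_sdiff.1 hc).2 hx]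
    exact D.chart_carrier c _ x hx
  chart_disjoint c _ c' _ h := D.chart_disjoint c _ c' _ h
  flat p hp hpc := D.flat_smoothSet T A hp fun h => by
    by_contra hT
    exact hpc (Finset.mem_sdiff.2 ⟨h, hT⟩)

/-- The collection of circles which the Kauffman state with set of `∞`-markers `A` produces. -/
def state (D : Diagram F) (A : Finset F) : Set F := D.smoothSet D.crossings A

theorem isCurve_state (D : Diagram F) (A : Finset F) : IsCurve (D.state A) :=
  ⟨D.isClosed_smoothSet _ A, fun _ hp => D.flat_smoothSet _ A hp id⟩

/-- The number `μ` of inessential circles of a state. -/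
def stateTrivial (D : Diagram F) (A : Finset F) : ℕ := numTrivial (D.state A)

/-- The isotopy class of the collection of essential circles of a state. -/
def stateClass (D : Diagram F) (A : Finset F) : CurveClass F :=
  (D.isCurve_state A).essentialSystem.toClass

section StateLemmas

theorem smoothSet_image {D D' : Diagram F} {h : F ≃ₜ F}
    (h1 : ∀ x, h x ∈ D'.carrier ↔ x ∈ D.carrier)
    (h2 : ∀ c, h c ∈ D'.crossings ↔ c ∈ D.crossings)
    (h3 : ∀ c hc hc', ∀ x,
      (h x ∈ (D'.chart (h c) hc').source ↔ x ∈ (D.chart c hc).source) ∧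
      (x ∈ (D.chart c hc).source →
        (D'.chart (h c) hc').toFun (h x) = (D.chart c hc).toFun x))
    (T A : Finset F) :
    D'.smoothSet (T.map h.toEquiv.toEmbedding) (A.map h.toEquiv.toEmbedding) =
      h '' D.smoothSet T A := by
  have hmem : ∀ (B : Finset F) c, h c ∈ B.map h.toEquiv.toEmbedding ↔ c ∈ B := fun B c =>
    Finset.mem_map' h.toEquiv.toEmbedding
  ext y
  obtain ⟨x, rfl⟩ := h.surjective y
  rw [h.injective.mem_set_image]
  by_cases hx : ∃ c hc, c ∈ T ∧ x ∈ (D.chart c hc).source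
  · obtain ⟨c, hc, hT, hxc⟩ := hx
    have hc' := (h2 c).2 hc
    rw [D.mem_smoothSet_iff_marker T A hc hT hxc,
      D'.mem_smoothSet_iff_marker _ _ hc' ((hmem T c).2 hT) ((h3 c hc hc' x).1.2 hxc),
      (h3 c hc hc' x).2 hxc, propext (hmem A c)]
  · push Not at hx
    rw [D.mem_smoothSet_iff_carrier T A hx, D'.mem_smoothSet_iff_carrier, h1]
    intro c' hc' hT' hx'
    obtain ⟨c, rfl⟩ := h.surjective c'
    have hc := (h2 c).1 hc'
    exact hx c hc ((hmem T c).1 hT') ((h3 c hc hc' x).1.1 hx')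

open Classical in
theorem smooth_smoothSet (D : Diagram F) {T B A A' : Finset F}
    (h : ∀ c ∈ D.crossings, c ∈ A' ↔ (c ∈ T ∧ c ∈ B) ∨ (c ∉ T ∧ c ∈ A)) :
    (D.smooth T B).state A = D.state A' := by
  ext x
  by_cases hx : ∃ c, ∃ hc : c ∈ D.crossings, x ∈ (D.chart c hc).source
  · obtain ⟨c, hc, hxc⟩ := hx
    rw [state, state, D.mem_smoothSet_iff_marker _ A' hc hc hxc]
    by_cases hT : c ∈ T
    · have e1 : x ∈ (D.smooth T B).smoothSet (D.smooth T B).crossings A ↔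
          x ∈ (D.smooth T B).carrier := by
        refine mem_smoothSet_iff_carrier _ _ _ fun c' hc' _ hx' => ?_
        have hne : c ≠ c' := by rintro rfl; exact (Finset.mem_sdiff.1 hc').2 hT
        exact disjoint_left.1 (D.chart_disjoint c hc c' _ hne) hxc hx'
      have e2 : (c ∈ A') = (c ∈ B) := by
        rw [propext (h c hc)]; simp [hT]
      rw [e1, e2]
      exact D.mem_smoothSet_iff_marker T B hc hT hxc
    · have hc' : c ∈ (D.smooth T B).crossings := Finset.mem_sdiff.2 ⟨hc, hT⟩
      have e2 : (c ∈ A') = (c ∈ A) := by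
        rw [propext (h c hc)]; simp [hT]
      rw [e2]
      exact (D.smooth T B).mem_smoothSet_iff_marker _ A hc' hc' hxc
  · push Not at hx
    have e1 : x ∈ (D.smooth T B).state A ↔ x ∈ (D.smooth T B).carrier :=
      mem_smoothSet_iff_carrier _ _ _ fun c hc _ => hx c (Finset.mem_sdiff.1 hc).1
    have e2 : x ∈ D.state A' ↔ x ∈ D.carrier :=
      mem_smoothSet_iff_carrier _ _ _ fun c hc _ => hx c hc
    have e3 : x ∈ (D.smooth T B).carrier ↔ x ∈ D.carrier :=
      D.mem_smoothSet_iff_carrier _ _ fun c hc _ => hx c hc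
    rw [e1, e2, e3]

theorem stateClass_congr {D D' : Diagram F} {A A' : Finset F} (h : D.state A = D'.state A') :
    D.stateClass A = D'.stateClass A' := by
  refine Quotient.sound ⟨AmbientIsotopy.refl, ?_⟩
  have : (fun x : F => x) '' essentialPart (D.state A) = essentialPart (D'.state A') := by
    rw [h, image_id']
  exact this

theorem stateTrivial_congr {D D' : Diagram F} {A A' : Finset F} (h : D.state A = D'.state A') :
    D.stateTrivial A = D'.stateTrivial A' := by
  rw [stateTrivial, stateTrivial, h]

theorem boundsDisk_image (h : F ≃ₜ F) {C : Set F} (hC : BoundsDisk C) : BoundsDisk (h '' C) := by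
  obtain ⟨f, h1, h2, h3⟩ := hC
  exact ⟨h ∘ f, h.continuous.comp_continuousOn h1, h.injective.comp_injOn h2, by
    rw [image_comp, h3]⟩

theorem boundsDisk_image_iff (h : F ≃ₜ F) {C : Set F} : BoundsDisk (h '' C) ↔ BoundsDisk C := by
  refine ⟨fun hC => ?_, boundsDisk_image h⟩
  have := boundsDisk_image h.symm hC
  rwa [← image_comp, h.symm_comp_self, image_id] at this

theorem essentialPart_image (h : F ≃ₜ F) (S : Set F) :
    essentialPart (h '' S) = h '' essentialPart S := by
  ext y
  obtain ⟨x, rfl⟩ := h.surjective y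
  rw [h.injective.mem_set_image]
  constructor
  · rintro ⟨hx, hd⟩
    have hx' := h.injective.mem_set_image.1 hx
    refine ⟨hx', fun hb => hd ?_⟩
    rw [← h.image_connectedComponentIn hx']
    exact boundsDisk_image h hb
  · rintro ⟨hx, hd⟩
    refine ⟨mem_image_of_mem _ hx, fun hb => hd ?_⟩
    rwa [← h.image_connectedComponentIn hx, boundsDisk_image_iff] at hb

theorem numTrivial_image (h : F ≃ₜ F) (S : Set F) : numTrivial (h '' S) = numTrivial S := by
  have : trivialComponents (h '' S) = (fun C => h '' C) '' trivialComponents S := by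
    ext C
    constructor
    · rintro ⟨⟨_, ⟨x, hx, rfl⟩, rfl⟩, hb⟩
      rw [← h.image_connectedComponentIn hx] at hb ⊢
      exact ⟨_, ⟨⟨x, hx, rfl⟩, (boundsDisk_image_iff h).1 hb⟩, rfl⟩
    · rintro ⟨_, ⟨⟨x, hx, rfl⟩, hb⟩, rfl⟩
      refine ⟨⟨h x, mem_image_of_mem _ hx, ?_⟩, boundsDisk_image h hb⟩
      exact (h.image_connectedComponentIn hx).symm
  rw [numTrivial, this, ncard_image_of_injective _ h.injective.image_injective, numTrivial]

theorem connectedComponentIn_union {S U : Set F} (hS : IsClosed S) (hU : IsClosed U)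
    (hd : Disjoint S U) {x : F} (hx : x ∈ S) :
    connectedComponentIn (S ∪ U) x = connectedComponentIn S x := by
  refine Subset.antisymm ?_ (connectedComponentIn_mono x subset_union_left)
  have hpre : IsPreconnected (connectedComponentIn (S ∪ U) x) :=
    isPreconnected_connectedComponentIn
  have hmem : x ∈ connectedComponentIn (S ∪ U) x := mem_connectedComponentIn (Or.inl hx)
  have hsub := connectedComponentIn_subset (S ∪ U) x
  refine hpre.subset_connectedComponentIn hmem fun y hy => ?_
  by_contra hyS
  have hyU : y ∈ U := (hsub hy).resolve_left hyS
  obtain ⟨z, -, hz1, hz2⟩ := isPreconnected_closed_iff.1 hpre S U hS hU hsub ⟨x, hmem, hx⟩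
    ⟨y, hy, hyU⟩
  exact disjoint_left.1 hd hz1 hz2

theorem connectedComponentIn_union_right {S U : Set F} (hS : IsClosed S) (hU : IsClosed U)
    (hd : Disjoint S U) (hc : IsPreconnected U) {x : F} (hx : x ∈ U) :
    connectedComponentIn (S ∪ U) x = U := by
  rw [union_comm, connectedComponentIn_union hU hS hd.symm hx]
  exact Subset.antisymm (connectedComponentIn_subset _ _)
    (hc.subset_connectedComponentIn hx subset_rfl)

theorem essentialPart_union {S U : Set F} (hS : IsClosed S) (hU : IsClosed U)
    (hd : Disjoint S U) (hc : IsPreconnected U) (hb : BoundsDisk U) :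
    essentialPart (S ∪ U) = essentialPart S := by
  ext x
  constructor
  · rintro ⟨hx | hx, h⟩
    · rw [connectedComponentIn_union hS hU hd hx] at h
      exact ⟨hx, h⟩
    · rw [connectedComponentIn_union_right hS hU hd hc hx] at h
      exact absurd hb h
  · rintro ⟨hx, h⟩
    refine ⟨Or.inl hx, ?_⟩
    rwa [connectedComponentIn_union hS hU hd hx]

theorem numTrivial_union {S U : Set F} (hS : IsClosed S) (hU : IsClosed U)
    (hfin : (trivialComponents S).Finite)
    (hd : Disjoint S U) (hc : IsConnected U) (hb : BoundsDisk U) :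
    numTrivial (S ∪ U) = numTrivial S + 1 := by
  have : trivialComponents (S ∪ U) = insert U (trivialComponents S) := by
    ext C
    constructor
    · rintro ⟨⟨x, hx | hx, rfl⟩, h⟩
      · rw [connectedComponentIn_union hS hU hd hx] at h ⊢
        exact Or.inr ⟨⟨x, hx, rfl⟩, h⟩
      · exact Or.inl (connectedComponentIn_union_right hS hU hd hc.isPreconnected hx)
    · rintro (rfl | ⟨⟨x, hx, rfl⟩, h⟩)
      · obtain ⟨x, hx⟩ := hc.nonempty
        exact ⟨⟨x, Or.inr hx, connectedComponentIn_union_right hS hU hd hc.isPreconnected hx⟩, hb⟩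
      · exact ⟨⟨x, Or.inl hx, connectedComponentIn_union hS hU hd hx⟩, h⟩
  rw [numTrivial, this, ncard_insert_of_notMem _ hfin, numTrivial]
  rintro ⟨⟨x, hx, hxU⟩, -⟩
  exact disjoint_left.1 hd hx (hxU ▸ mem_connectedComponentIn hx)

theorem state_union_trivial {D D' : Diagram F} {U : Set F} (hd : Disjoint D.carrier U)
    (h1 : D'.carrier = D.carrier ∪ U) (h2 : D'.crossings = D.crossings)
    (h3 : ∀ c hc hc', D'.chart c hc' = D.chart c hc) (A : Finset F) :
    D'.state A = D.state A ∪ U ∧ Disjoint (D.state A) U := by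
  have hU : ∀ c hc, ∀ x ∈ (D.chart c hc).source, x ∉ U := by
    intro c hc x hx hxU
    have hc' : c ∈ D'.crossings := h2 ▸ hc
    have e := D'.chart_carrier c hc' x (by rw [h3 c hc hc']; exact hx)
    rw [h3 c hc hc', ← D.chart_carrier c hc x hx, h1] at e
    exact disjoint_left.1 hd (e.1 (Or.inr hxU)) hxU
  constructor
  · ext x
    by_cases hx : ∃ c, ∃ hc : c ∈ D.crossings, x ∈ (D.chart c hc).source
    · obtain ⟨c, hc, hxc⟩ := hx
      have hc' : c ∈ D'.crossings := h2 ▸ hc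
      have hxc' : x ∈ (D'.chart c hc').source := by rw [h3 c hc hc']; exact hxc
      rw [mem_union, state, state, D.mem_smoothSet_iff_marker _ A hc hc hxc,
        D'.mem_smoothSet_iff_marker _ A hc' hc' hxc', h3 c hc hc']
      exact ⟨Or.inl, fun h => h.resolve_right (hU c hc x hxc)⟩
    · push Not at hx
      rw [mem_union, state, state, D.mem_smoothSet_iff_carrier _ A fun c hc _ => hx c hc,
        D'.mem_smoothSet_iff_carrier _ A, h1, mem_union]
      intro c hc' _
      have hc : c ∈ D.crossings := h2 ▸ hc'
      rw [h3 c hc hc']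
      exact hx c hc
  · rw [disjoint_left]
    intro x hx hxU
    have := (D.mem_smoothSet_iff_carrier D.crossings A
      fun c hc _ hxc => hU c hc x hxc hxU).1 hx
    exact disjoint_left.1 hd this hxU

end StateLemmas

end Diagram

/-! ### The Kauffman bracket -/

open LaurentPolynomial

section Bracket

variable [T2Space F] (k : Type v) [CommRing k]

/-- The value `-t² - t⁻²` of a trivial circle. -/
def loopValue : k[T;T⁻¹] := -T 2 - T (-2)

open Classical in
/-- The Kauffman bracket `⟨D⟩ = ∑_σ (-t)^(ζ(σ) - ι(σ)) (-t² - t⁻²)^μ(σ) D(σ)` of a diagram. A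
state `σ` is given by the set `A` of crossings with marker `∞`, so that `ι = |A|`. -/
def bracketDiagram (D : Diagram F) : CurveClass F →₀ k[T;T⁻¹] :=
  ∑ A ∈ D.crossings.powerset,
    Finsupp.single (D.stateClass A)
      ((-T 1) ^ (D.crossings \ A).card * (-T (-1)) ^ A.card * loopValue k ^ D.stateTrivial A)

/-- The Kauffman bracket as a linear map on the free module on diagrams. -/
def bracket : (Diagram F →₀ k[T;T⁻¹]) →ₗ[k[T;T⁻¹]] (CurveClass F →₀ k[T;T⁻¹]) :=
  Finsupp.linearCombination k[T;T⁻¹] (bracketDiagram k)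

variable (F) in
/-- The submodule of relations of the skein module: isotopy, the Kauffman skein relation
`K + t K₀ + t⁻¹ K_∞`, and `K ⨿ U + (t² + t⁻²) K` for trivial components `U`. -/
def skeinRelations : Submodule k[T;T⁻¹] (Diagram F →₀ k[T;T⁻¹]) :=
  Submodule.span k[T;T⁻¹]
    ({x | ∃ D D' : Diagram F, D.Isotopic D' ∧ x = Finsupp.single D 1 - Finsupp.single D' 1} ∪
     {x | ∃ (D : Diagram F), ∃ c ∈ D.crossings,
        x = Finsupp.single D 1 + Finsupp.single (D.smooth {c} ∅) (T 1) +
          Finsupp.single (D.smooth {c} {c}) (T (-1))} ∪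
     {x | ∃ D D' : Diagram F, D.IsUnionTrivial D' ∧
        x = Finsupp.single D' 1 + Finsupp.single D (T 2 + T (-2))})

variable (F) in
/-- The Kauffman bracket skein module `𝔎(F)`. -/
abbrev SkeinModule := (Diagram F →₀ k[T;T⁻¹]) ⧸ skeinRelations F k

/-- The class `[D]` of a diagram in the skein module. -/
def skeinClass (D : Diagram F) : SkeinModule F k :=
  Submodule.Quotient.mk (Finsupp.single D 1)

theorem bracketDiagram_isotopic {D D' : Diagram F} (h : D.Isotopic D') :
    bracketDiagram k D' = bracketDiagram k D := by
  classical
  obtain ⟨H, h1, h2, h3⟩ := h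
  set φ := H.endHomeo.toEquiv.toEmbedding with hφ
  have hcr : D'.crossings = D.crossings.map φ := by
    ext y
    obtain ⟨x, rfl⟩ := H.endHomeo.surjective y
    rw [h2]
    exact (Finset.mem_map' φ).symm
  have hst : ∀ A, D'.state (A.map φ) = H.endHomeo '' D.state A := by
    intro A
    rw [Diagram.state, Diagram.state, hcr]
    exact Diagram.smoothSet_image h1 h2 h3 _ _
  symm
  unfold bracketDiagram
  refine Finset.sum_bij (fun A _ => A.map φ) ?_ ?_ ?_ ?_
  · intro A hA
    rw [Finset.mem_powerset] at hA ⊢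
    rw [hcr]; exact Finset.map_subset_map.2 hA
  · intro A _ B _ hAB
    exact Finset.map_injective φ hAB
  · intro B hB
    rw [Finset.mem_powerset, hcr] at hB
    obtain ⟨A, hA, rfl⟩ := Finset.subset_map_iff.1 hB
    exact ⟨A, Finset.mem_powerset.2 hA, rfl⟩
  · intro A _
    have e1 : D.stateClass A = D'.stateClass (A.map φ) := by
      refine Quotient.sound ⟨H, ?_⟩
      have : H.endHomeo '' essentialPart (D.state A) = essentialPart (D'.state (A.map φ)) := by
        rw [hst, Diagram.essentialPart_image]
      exact this
    have e2 : D.stateTrivial A = D'.stateTrivial (A.map φ) := by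
      rw [Diagram.stateTrivial, Diagram.stateTrivial, hst, Diagram.numTrivial_image]
    rw [e1, e2, hcr, ← Finset.map_sdiff, Finset.card_map, Finset.card_map]

theorem bracketDiagram_resolution (D : Diagram F) {c : F} (hc : c ∈ D.crossings) :
    bracketDiagram k D + (T 1 : k[T;T⁻¹]) • bracketDiagram k (D.smooth {c} ∅) +
      (T (-1) : k[T;T⁻¹]) • bracketDiagram k (D.smooth {c} {c}) = 0 := by
  classical
  have hins : D.crossings = insert c (D.crossings.erase c) := (Finset.insert_erase hc).symm
  have hs : ∀ B : Finset F, (D.smooth {c} B).crossings = D.crossings.erase c := by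
    intro B
    ext x
    simp [Diagram.smooth, and_comm]
  have hnot := Finset.notMem_erase c D.crossings
  unfold bracketDiagram
  rw [hs, hs, Finset.smul_sum, Finset.smul_sum]
  conv_lhs => enter [1, 1, 1]; rw [hins]
  rw [Finset.sum_powerset_insert hnot, add_assoc, add_add_add_comm, ← Finset.sum_add_distrib,
    ← Finset.sum_add_distrib]
  rw [Finset.sum_eq_zero, Finset.sum_eq_zero, add_zero]
  · intro A hA
    rw [Finset.mem_powerset] at hA
    have hcA : c ∉ A := fun h => hnot (hA h)
    have e : (D.smooth {c} {c}).state A = D.state (insert c A) := by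
      refine Diagram.smooth_smoothSet D fun x _ => ?_
      by_cases hxc : x = c <;> simp [hxc]
    rw [Diagram.stateClass_congr e, Diagram.stateTrivial_congr e, Finsupp.smul_single,
      ← Finsupp.single_add, Finsupp.single_eq_zero.2]
    have e1 : D.crossings \ insert c A = D.crossings.erase c \ A := by
      ext x; simp only [Finset.mem_sdiff, Finset.mem_insert, Finset.mem_erase]; tauto
    rw [e1, Finset.card_insert_of_notMem hcA, smul_eq_mul]
    ring
  · intro A hA
    rw [Finset.mem_powerset] at hA
    have hcA : c ∉ A := fun h => hnot (hA h)
    have e : (D.smooth {c} ∅).state A = D.state A := by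
      refine Diagram.smooth_smoothSet D fun x _ => ?_
      by_cases hxc : x = c
      · simp [hxc, hcA]
      · simp [hxc]
    rw [Diagram.stateClass_congr e, Diagram.stateTrivial_congr e, Finsupp.smul_single,
      ← Finsupp.single_add, Finsupp.single_eq_zero.2]
    have e1 : D.crossings \ A = insert c (D.crossings.erase c \ A) := by
      ext x
      simp only [Finset.mem_sdiff, Finset.mem_insert, Finset.mem_erase]
      by_cases hxc : x = c
      · subst hxc; simp [hc, hcA]
      · simp [hxc]
    rw [e1, Finset.card_insert_of_notMem (by simp), smul_eq_mul]
    ring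

theorem bracketDiagram_unionTrivial [CompactSpace F] {D D' : Diagram F}
    (h : D.IsUnionTrivial D') :
    bracketDiagram k D' + (T 2 + T (-2) : k[T;T⁻¹]) • bracketDiagram k D = 0 := by
  classical
  obtain ⟨f, hf, hinj, hd, h1, h2, h3⟩ := h
  set U := f '' Metric.sphere 0 1 with hUdef
  have hb : BoundsDisk U := ⟨f, hf, hinj, rfl⟩
  have hcon : IsConnected U := by
    refine IsConnected.image ?_ f (hf.mono Metric.sphere_subset_closedBall)
    refine isConnected_sphere ?_ _ zero_le_one
    rw [← Module.finrank_eq_rank, finrank_euclideanSpace_fin]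
    norm_num
  have hcl : IsClosed U := by
    refine ((isCompact_sphere (0 : Plane) 1).image_of_continuousOn ?_).isClosed
    exact hf.mono Metric.sphere_subset_closedBall
  have hd' : Disjoint D.carrier U :=
    hd.mono_right (image_mono Metric.sphere_subset_closedBall)
  unfold bracketDiagram
  rw [h2, Finset.smul_sum, ← Finset.sum_add_distrib]
  refine Finset.sum_eq_zero fun A _ => ?_
  obtain ⟨s1, s2⟩ := Diagram.state_union_trivial hd' h1 h2 h3 A
  have hS := D.isCurve_state A
  have e1 : D'.stateClass A = D.stateClass A := by
    refine Quotient.sound ⟨AmbientIsotopy.refl, ?_⟩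
    have : (fun x : F => x) '' essentialPart (D'.state A) = essentialPart (D.state A) := by
      rw [s1, image_id', Diagram.essentialPart_union hS.isClosed hcl s2 hcon.isPreconnected hb]
    exact this
  have e2 : D'.stateTrivial A = D.stateTrivial A + 1 := by
    rw [Diagram.stateTrivial, s1,
      Diagram.numTrivial_union hS.isClosed hcl hS.finite_trivialComponents s2 hcon hb,
      Diagram.stateTrivial]
  rw [e1, e2, Finsupp.smul_single, ← Finsupp.single_add, Finsupp.single_eq_zero.2]
  rw [smul_eq_mul, loopValue]
  ring

/-- The bracket respects the skein relations. -/
theorem skeinRelations_le_ker [CompactSpace F] :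
    skeinRelations F k ≤ LinearMap.ker (bracket (F := F) k) := by
  refine Submodule.span_le.2 ?_
  rintro x ((⟨D, D', h, rfl⟩ | ⟨D, c, hc, rfl⟩) | ⟨D, D', h, rfl⟩)
  · simp [bracket, bracketDiagram_isotopic k h]
  · simpa [bracket] using bracketDiagram_resolution k D hc
  · simpa only [bracket, SetLike.mem_coe, LinearMap.mem_ker, map_add, map_sub,
      Finsupp.linearCombination_single, one_smul] using bracketDiagram_unionTrivial k h

/-- The map `𝔎(F) → k[t, t⁻¹]ℭ(F)`, `[D] ↦ ⟨D⟩`, expanding elements of the skein module in terms of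
curve systems. -/
def curveExpansion [CompactSpace F] :
    SkeinModule F k →ₗ[k[T;T⁻¹]] (CurveClass F →₀ k[T;T⁻¹]) :=
  (skeinRelations F k).liftQ (bracket k) (skeinRelations_le_ker k)

end Bracket

/-! ### The star product and its coefficients -/

/-- A diagram `α ▷ β` of `α` over `β`: the union of a curve system of class `α` and one of class
`β` in general position, all crossings being crossings of the former over the latter. -/
structure StackedDiagram (α β : CurveClass F) extends Diagram F where
  top : CurveSystem F
  bottom : CurveSystem F
  top_class : top.toClass = α
  bottom_class : bottom.toClass = β
  carrier_eq : carrier = top.carrier ∪ bottom.carrier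
  mem_crossings : ∀ x, x ∈ crossings ↔ x ∈ top.carrier ∧ x ∈ bottom.carrier
  over_strand : ∀ c hc, ∀ x ∈ (chart c hc).source,
    x ∈ top.carrier ↔ (chart c hc).toFun x 0 = (chart c hc).toFun x 1
  under_strand : ∀ c hc, ∀ x ∈ (chart c hc).source,
    x ∈ bottom.carrier ↔ (chart c hc).toFun x 0 = -(chart c hc).toFun x 1

section Expansion

variable [T2Space F] [CompactSpace F] (k : Type v) [CommRing k] [Algebra ℚ k]

/-- The power series `e^h` as a unit. -/
def expUnit : (PowerSeries k)ˣ where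
  val := PowerSeries.exp k
  inv := PowerSeries.evalNegHom (PowerSeries.exp k)
  val_inv := PowerSeries.exp_mul_exp_neg_eq_one
  inv_val := by rw [mul_comm]; exact PowerSeries.exp_mul_exp_neg_eq_one

/-- The ring homomorphism `k[t, t⁻¹] → k[[h]]`, `t ↦ e^h`. -/
def expHom : k[T;T⁻¹] →+* PowerSeries k := LaurentPolynomial.eval₂ PowerSeries.C (expUnit k)

/-- The coefficient of `h^n` of an element of `k[t, t⁻¹]ℭ(F)`, with `t = e^h`. -/
def hCoeff (n : ℕ) (x : CurveClass F →₀ k[T;T⁻¹]) : CurveClass F →₀ k :=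
  x.mapRange (fun p => PowerSeries.coeff n (expHom k p)) (by simp)

/-- The term `⟨D⟩_n` of order `n` of the bracket of a diagram. -/
def bracketCoeff (n : ℕ) (D : Diagram F) : CurveClass F →₀ k :=
  hCoeff k n (curveExpansion k (skeinClass k D))

/-- The star product `α ⋆ β`: the product of `α` and `β` in the skein module is represented by the
link obtained by placing `α` over `β` (that is, `α ⋆ β = ⟨α ▷ β⟩`), and is expanded in terms of curve systems. -/
def starProduct {α β : CurveClass F} (D : StackedDiagram α β) : CurveClass F →₀ k[T;T⁻¹] :=
  curveExpansion k (skeinClass k D.toDiagram)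

/-- The coefficient `λ_n(α, β)` of `h^n` in the star product. -/
def starCoeff (n : ℕ) {α β : CurveClass F} (D : StackedDiagram α β) : CurveClass F →₀ k :=
  hCoeff k n (starProduct k D)

end Expansion

/-! ### Resolution operators -/

section Resolution

variable [T2Space F] {k : Type v} [CommRing k]

open Classical in
/-- The resolution operator `χ(P)` of a polynomial `P(z, w)`, with `z = X 0` and `w = X 1`: on the
homogeneous component of degree `n` it is `(-1)^n` times the sum over all states on `n`-element
sets `T` of crossings, a state with `i` markers `∞` being weighted by the coefficient of
`z^i w^(n-i)`. -/
def chi (P : MvPolynomial (Fin 2) k) : (Diagram F →₀ k) →ₗ[k] (Diagram F →₀ k) :=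
  Finsupp.linearCombination k fun D =>
    ∑ n ∈ Finset.range (P.totalDegree + 1), ∑ T ∈ D.crossings.powersetCard n, ∑ A ∈ T.powerset,
      Finsupp.single (D.smooth T A)
        ((-1) ^ n * P.coeff (Finsupp.single 0 A.card + Finsupp.single 1 (T \ A).card))

/-- The projection `φ_*` of a map `φ`: smooth all crossings in all ways, with sign `(-1)^c`,
discard the trivial circles and weight a state with `μ` trivial circles by `φ(μ)`. -/
def project (φ : ℕ → k) : (Diagram F →₀ k) →ₗ[k] (CurveClass F →₀ k) :=
  Finsupp.linearCombination k fun D =>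
    ∑ A ∈ D.crossings.powerset,
      Finsupp.single (D.stateClass A) ((-1) ^ D.crossings.card * φ (D.stateTrivial A))

variable (k) in
/-- `φ_j(i)`: the coefficient of `h^(2j)` in `(-t² - t⁻²)^i`, where `t = e^h`. -/
def loopCoeff [Algebra ℚ k] (j i : ℕ) : k :=
  algebraMap ℚ k (PowerSeries.coeff (2 * j) (expHom ℚ (loopValue ℚ ^ i)))

/-- The sum `∑_{j ≤ n/2} (φ_j)_* χ(P_{n-2j})(D)` for a sequence of rational polynomials. -/
def resolutionSum (k : Type v) [CommRing k] [Algebra ℚ k] (P : ℕ → MvPolynomial (Fin 2) ℚ)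
    (n : ℕ) (D : Diagram F) : CurveClass F →₀ k :=
  ∑ j ∈ Finset.range (n / 2 + 1),
    project (loopCoeff k j)
      (chi ((P (n - 2 * j)).map (algebraMap ℚ k)) (Finsupp.single D 1))

end Resolution

end Surface

end KauffmanStar

end

open KauffmanStar

namespace KauffmanStar

open PowerSeries LaurentPolynomial

/-! ### The resolution polynomials -/

/-! Fix a full state with `p` markers `∞` and `q` markers `0`. Under `t = e^h` its coefficient in
the bracket becomes `(-1)^(q+p) e^((q-p)h) (-t² - t⁻²)^μ`. The loop factor is even in `h`, and its
coefficients are the `φ_j(μ)`. So the term of order `n` only asks for the coefficients of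
`e^((q-p)h)` at the orders `n - 2j`.

These come from writing each crossing's factor as `e^(±h) = 1 + (e^(±h) - 1)` and expanding the
product: `e^((q-p)h)` is the sum, over all sets `S` of crossings, of `(e^(-h) - 1)^i (e^h - 1)^j`,
where `i` and `j` count the markers `∞` and `0` of the state on `S` (`sum_resolutionWeight`). Each
summand depends on the partial state only through `(i, j)`, so its coefficient of `h^n` can serve as
the coefficient of `z^i w^j` in a universal polynomial `P_n`. Both factors are divisible by `h`,
with leading terms `-h` and `h`; this gives the degree and the top homogeneous component of `P_n`.

On the resolution side, smoothing a set `S` and then all remaining crossings runs through the pairs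
of a full state and a subset `S` of the crossings. The signs `(-1)^|S|` and `(-1)^(c-|S|)` of the
two operations multiply to `(-1)^c`. Exchanging the two sums (`project_chi_single`) makes both sides
agree state by state. The star product is the bracket of a stacked diagram, so it is covered by the
same identity. -/

/-- The coefficient of `h ^ n` in `(e^(-h) - 1) ^ i * (e^h - 1) ^ j`. -/
noncomputable def resolutionWeight (n i j : ℕ) : ℚ :=
  PowerSeries.coeff n ((evalNegHom (PowerSeries.exp ℚ) - 1) ^ i * (PowerSeries.exp ℚ - 1) ^ j)

/-- Both series vanish to order exactly one at `h = 0`. The cofactors with their constant terms `1`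
and `-1` are all that the degree and leading form of the polynomials require. -/
theorem exists_expSubOne_factors : ∃ g g' : PowerSeries ℚ,
    constantCoeff g = 1 ∧ constantCoeff g' = -1 ∧
      PowerSeries.exp ℚ - 1 = PowerSeries.X * g ∧
      evalNegHom (PowerSeries.exp ℚ) - 1 = PowerSeries.X * g' := by
  have h : (PowerSeries.X : PowerSeries ℚ) ∣ PowerSeries.exp ℚ - 1 := by
    rw [PowerSeries.X_dvd_iff]; simp
  obtain ⟨g, hg⟩ := h
  have h1 : constantCoeff g = 1 := by
    have := congrArg (PowerSeries.coeff 1) hg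
    rw [PowerSeries.coeff_succ_X_mul, PowerSeries.coeff_zero_eq_constantCoeff_apply] at this
    rw [← this]
    simp [PowerSeries.coeff_exp, PowerSeries.coeff_one]
  -- Substituting `-h` for `h` in `h g(h)` gives `h · (-g(-h))`, which dictates the second cofactor.
  refine ⟨g, -evalNegHom g, h1, ?_, hg, ?_⟩
  · rw [map_neg, ← PowerSeries.coeff_zero_eq_constantCoeff_apply, evalNegHom,
      PowerSeries.coeff_rescale]
    simp [h1]
  · rw [← map_one (evalNegHom (A := ℚ)), ← map_sub, hg, map_mul, evalNegHom_X]
    ring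

/-- The product is divisible by `h^(i+j)`. -/
theorem resolutionWeight_eq_zero {n i j : ℕ} (h : n < i + j) : resolutionWeight n i j = 0 := by
  obtain ⟨g, g', -, -, e, e'⟩ := exists_expSubOne_factors
  rw [resolutionWeight, e, e', show (PowerSeries.X * g') ^ i * (PowerSeries.X * g) ^ j =
    PowerSeries.X ^ (i + j) * (g' ^ i * g ^ j) by ring, PowerSeries.coeff_X_pow_mul',
    if_neg (not_le.2 h)]

/-- The lowest coefficient of the product is the product of the constant terms of the cofactors,
`(-1)^i · 1^j`. -/
theorem resolutionWeight_add (i j : ℕ) : resolutionWeight (i + j) i j = (-1) ^ i := by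
  obtain ⟨g, g', h, h', e, e'⟩ := exists_expSubOne_factors
  rw [resolutionWeight, e, e', show (PowerSeries.X * g') ^ i * (PowerSeries.X * g) ^ j =
    PowerSeries.X ^ (i + j) * (g' ^ i * g ^ j) by ring, PowerSeries.coeff_X_pow_mul',
    if_pos le_rfl, Nat.sub_self, PowerSeries.coeff_zero_eq_constantCoeff_apply]
  simp [h, h']

/-- The polynomial in `z = X 0` and `w = X 1` whose resolution operator computes the term of order
`n` of `e^((ζ - ι) h)`, for a state with `ζ` markers `0` and `ι` markers `∞`. -/
noncomputable def resolutionPoly (n : ℕ) : MvPolynomial (Fin 2) ℚ :=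
  ∑ i ∈ Finset.range (n + 1), ∑ j ∈ Finset.range (n + 1),
    MvPolynomial.monomial (Finsupp.single 0 i + Finsupp.single 1 j) (resolutionWeight n i j)

theorem single_add_single_eq_iff {i j : ℕ} {d : Fin 2 →₀ ℕ} :
    Finsupp.single 0 i + Finsupp.single 1 j = d ↔ i = d 0 ∧ j = d 1 := by
  constructor
  · rintro rfl; simp
  · rintro ⟨rfl, rfl⟩
    ext a; fin_cases a <;> simp

/-- The defining sum runs over a square of exponents up to `n`; beyond it the weights vanish, so the
formula needs no bound on `d`. -/
theorem coeff_resolutionPoly (n : ℕ) (d : Fin 2 →₀ ℕ) :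
    (resolutionPoly n).coeff d = resolutionWeight n (d 0) (d 1) := by
  classical
  simp only [resolutionPoly, MvPolynomial.coeff_sum, MvPolynomial.coeff_monomial,
    single_add_single_eq_iff, ite_and]
  by_cases h0 : d 0 < n + 1
  · by_cases h1 : d 1 < n + 1
    · rw [Finset.sum_eq_single (d 0)]
      · simp only [if_true, Finset.sum_ite_eq', if_pos (Finset.mem_range.2 h1)]
      · intro b _ hb; simp [hb]
      · intro h; exact absurd (Finset.mem_range.2 h0) h
    · rw [resolutionWeight_eq_zero (by omega)]
      refine Finset.sum_eq_zero fun i _ => Finset.sum_eq_zero fun j hj => ?_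
      have := Finset.mem_range.1 hj
      rw [if_neg (show ¬ j = d 1 by omega), ite_self]
  · rw [resolutionWeight_eq_zero (by omega)]
    refine Finset.sum_eq_zero fun i hi => Finset.sum_eq_zero fun j _ => ?_
    have := Finset.mem_range.1 hi
    rw [if_neg (by omega)]

/-! ### Degree, top component and inhomogeneity of the polynomials. -/

theorem degree_fin_two (d : Fin 2 →₀ ℕ) : d.degree = d 0 + d 1 := by
  rw [Finsupp.degree_eq_sum, Fin.sum_univ_two]

theorem totalDegree_resolutionPoly (n : ℕ) : (resolutionPoly n).totalDegree = n := by
  refine le_antisymm ?_ ?_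
  · refine Finset.sup_le fun d hd => ?_
    rw [MvPolynomial.mem_support_iff, coeff_resolutionPoly] at hd
    by_contra h
    refine hd (resolutionWeight_eq_zero ?_)
    rw [← degree_fin_two, Finsupp.degree_apply]
    exact not_le.1 h
  -- The monomial `w^n` has coefficient `1`, so the degree is attained.
  · have h : (Finsupp.single 1 n : Fin 2 →₀ ℕ) ∈ (resolutionPoly n).support := by
      rw [MvPolynomial.mem_support_iff, coeff_resolutionPoly]
      have := resolutionWeight_add 0 n
      simp only [zero_add] at this
      simp [this]
    simpa using MvPolynomial.le_totalDegree h

theorem homogeneousComponent_resolutionPoly (n : ℕ) :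
    MvPolynomial.homogeneousComponent n (resolutionPoly n) =
      ∑ i ∈ Finset.range (n + 1),
        (-1) ^ i * MvPolynomial.X 0 ^ i * MvPolynomial.X 1 ^ (n - i) := by
  classical
  have e : ∀ i, ((-1) ^ i * MvPolynomial.X 0 ^ i * MvPolynomial.X 1 ^ (n - i) :
      MvPolynomial (Fin 2) ℚ) = MvPolynomial.monomial
        (Finsupp.single 0 i + Finsupp.single 1 (n - i)) ((-1) ^ i) := by
    intro i
    rw [MvPolynomial.X_pow_eq_monomial, MvPolynomial.X_pow_eq_monomial,
      show ((-1) ^ i : MvPolynomial (Fin 2) ℚ) = MvPolynomial.C ((-1) ^ i) by simp,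
      MvPolynomial.C_mul_monomial, MvPolynomial.monomial_mul]
    simp
  ext d
  simp only [e, MvPolynomial.coeff_homogeneousComponent, coeff_resolutionPoly,
    MvPolynomial.coeff_sum, MvPolynomial.coeff_monomial, single_add_single_eq_iff, ite_and,
    degree_fin_two]
  rw [Finset.sum_ite_eq']
  by_cases h : d 0 + d 1 = n
  · subst h
    rw [if_pos rfl, if_pos (Finset.mem_range.2 (by omega)), if_pos (by omega),
      resolutionWeight_add]
  · rw [if_neg h]
    split_ifs with h1 h2
    · have := Finset.mem_range.1 h1
      omega
    · rfl
    · rfl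

/-- The linear monomial `w` survives: its coefficient is that of `h^n` in `e^h - 1`, namely `1/n!`.
-/
theorem not_isHomogeneous_resolutionPoly {n : ℕ} (hn : 1 < n) :
    ¬ (resolutionPoly n).IsHomogeneous n := by
  intro h
  have h1 : (resolutionPoly n).coeff (Finsupp.single 1 1) ≠ 0 := by
    rw [coeff_resolutionPoly]
    have : resolutionWeight n 0 1 ≠ 0 := by
      have h0 : n ≠ 0 := by omega
      simp [resolutionWeight, PowerSeries.coeff_exp, PowerSeries.coeff_one, h0,
        Nat.factorial_ne_zero]
    simpa using this
  have h2 := h.degree_eq_sum_deg_support (MvPolynomial.mem_support_iff.2 h1)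
  simp at h2
  omega

/-! ### Expansion of a full state over its partial states. -/

/-- The weights of all partial states below a full state with `p` markers `∞` and `q` markers `0`
add up to the coefficient of `h ^ n` in `e^((q - p) h)`. -/
theorem sum_resolutionWeight {ι : Type*} [DecidableEq ι] (n : ℕ) (C A : Finset ι) (hA : A ⊆ C) :
    ∑ S ∈ C.powerset, resolutionWeight n (S ∩ A).card (S \ A).card =
      PowerSeries.coeff n
        (evalNegHom (PowerSeries.exp ℚ) ^ A.card * PowerSeries.exp ℚ ^ (C \ A).card) := by
  -- Expanding `∏ (1 + f c)` over subsets: `1 + f c` is `e^(-h)` or `e^h` according to the marker,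
  -- and a subset `S` collects the crossings from which the term `f c` is chosen.
  have h := Finset.prod_one_add (f := fun c => if c ∈ A then evalNegHom (PowerSeries.exp ℚ) - 1
    else PowerSeries.exp ℚ - 1) C
  have e : ∀ (S : Finset ι) (x y : PowerSeries ℚ),
      ∏ c ∈ S, (if c ∈ A then x else y) = x ^ (S ∩ A).card * y ^ (S \ A).card := by
    intro S x y
    rw [Finset.prod_ite, Finset.prod_const, Finset.prod_const, Finset.filter_mem_eq_inter,
      Finset.filter_notMem_eq_sdiff]
  have e' : ∀ c, (1 + if c ∈ A then evalNegHom (PowerSeries.exp ℚ) - 1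
      else PowerSeries.exp ℚ - 1) =
      if c ∈ A then evalNegHom (PowerSeries.exp ℚ) else PowerSeries.exp ℚ := by
    intro c; split_ifs <;> ring
  simp only [e', e] at h
  rw [Finset.inter_eq_right.2 hA] at h
  rw [h, map_sum]
  rfl

/-! ### Resolution operators on a diagram -/

section Resolution

variable {F : Type u} [TopologicalSpace F] [ChartedSpace (EuclideanHalfSpace 2) F] [T2Space F]
  {k : Type v} [CommRing k]

-- Removes the truncation at the total degree: a state on `S` is weighted by a coefficient of degree
-- `|S|`, which is zero for larger `S`. The layers by cardinality then merge into one sum over all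
-- subsets.
open Classical in
theorem chi_single (P : MvPolynomial (Fin 2) k) (D : Diagram F) :
    chi P (Finsupp.single D 1) =
      ∑ S ∈ D.crossings.powerset, ∑ A ∈ S.powerset,
        Finsupp.single (D.smooth S A) ((-1) ^ S.card *
          P.coeff (Finsupp.single 0 A.card + Finsupp.single 1 (S \ A).card)) := by
  set f : Finset F → (Diagram F →₀ k) := fun S => ∑ A ∈ S.powerset,
    Finsupp.single (D.smooth S A) ((-1) ^ S.card *
      P.coeff (Finsupp.single 0 A.card + Finsupp.single 1 (S \ A).card)) with hf
  have hz : ∀ S, P.totalDegree < S.card → f S = 0 := by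
    intro S hS
    refine Finset.sum_eq_zero fun A hA => ?_
    rw [MvPolynomial.coeff_eq_zero_of_totalDegree_lt, mul_zero, Finsupp.single_zero]
    rw [← Finsupp.degree_apply, degree_fin_two]
    have := Finset.card_sdiff_add_card_eq_card (Finset.mem_powerset.1 hA)
    simp
    omega
  have h1 : chi P (Finsupp.single D 1) =
      ∑ n ∈ Finset.range (P.totalDegree + 1), ∑ S ∈ D.crossings.powersetCard n, f S := by
    rw [chi, Finsupp.linearCombination_single, one_smul]
    refine Finset.sum_congr rfl fun n _ => Finset.sum_congr rfl fun S hS => ?_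
    rw [hf, ← (Finset.mem_powersetCard.1 hS).2]
  have h2 : ∀ n, ∑ S ∈ D.crossings.powersetCard n, f S =
      ∑ S ∈ D.crossings.powerset, if S.card = n then f S else 0 := by
    intro n
    rw [Finset.powersetCard_eq_filter, Finset.sum_filter]
  rw [h1]
  simp only [h2]
  -- With the sum over `S` outermost, the indicator `S.card = n` selects at most one `n`.
  rw [Finset.sum_comm]
  refine Finset.sum_congr rfl fun S _ => ?_
  rw [Finset.sum_ite_eq]
  split_ifs with h
  · rfl
  · rw [Finset.mem_range] at h
    exact (hz S (by omega)).symm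

/-- Choosing markers on `S` and then on the complement is the same as choosing them on all of `C`;
the inverse splits a full state `A` into `S ∩ A` and `A \ S`. -/
theorem sum_powerset_states {ι M : Type*} [DecidableEq ι] [AddCommMonoid M] {C S : Finset ι}
    (hS : S ⊆ C) (f : Finset ι → Finset ι → M) :
    ∑ B ∈ S.powerset, ∑ A ∈ (C \ S).powerset, f B (B ∪ A) =
      ∑ A ∈ C.powerset, f (S ∩ A) A := by
  rw [← Finset.sum_product']
  refine Finset.sum_bij' (fun p _ => p.1 ∪ p.2) (fun A _ => (S ∩ A, A \ S)) ?_ ?_ ?_ ?_ ?_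
  · rintro ⟨B, A⟩ h
    simp only [Finset.mem_product, Finset.mem_powerset] at h ⊢
    exact Finset.union_subset (h.1.trans hS) (h.2.trans Finset.sdiff_subset)
  · intro A h
    simp only [Finset.mem_product, Finset.mem_powerset] at h ⊢
    exact ⟨Finset.inter_subset_left, Finset.sdiff_subset_sdiff h le_rfl⟩
  · rintro ⟨B, A⟩ h
    simp only [Finset.mem_product, Finset.mem_powerset] at h
    have h1 := @h.1
    have h2 := @h.2
    ext x <;> have h1 := @h1 x <;> have h2 := @h2 x <;>
      simp only [Finset.mem_sdiff, Finset.mem_inter, Finset.mem_union] at * <;> tauto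
  · intro A _
    ext x
    simp only [Finset.mem_sdiff, Finset.mem_inter, Finset.mem_union]
    tauto
  · rintro ⟨B, A⟩ h
    simp only [Finset.mem_product, Finset.mem_powerset] at h
    have e : S ∩ (B ∪ A) = B := by
      ext x
      have h1 := @h.1 x
      have h2 := @h.2 x
      simp only [Finset.mem_sdiff, Finset.mem_inter, Finset.mem_union] at *
      tauto
    simp only [e]

-- Regroups the two-stage smoothing by its final full state `A`. Every `S` contributes to `A`
-- exactly once, through the partial state `S ∩ A`, so the polynomial enters only through a sum of
-- coefficients over all subsets.
open Classical in
theorem project_chi_single (φ : ℕ → k) (P : MvPolynomial (Fin 2) k) (D : Diagram F) :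
    project φ (chi P (Finsupp.single D 1)) =
      ∑ A ∈ D.crossings.powerset, Finsupp.single (D.stateClass A)
        ((-1) ^ D.crossings.card * φ (D.stateTrivial A) * ∑ S ∈ D.crossings.powerset,
          P.coeff (Finsupp.single 0 (S ∩ A).card + Finsupp.single 1 (S \ A).card)) := by
  have h : ∀ S ∈ D.crossings.powerset, ∀ B ∈ S.powerset, ∀ r : k,
      project φ (Finsupp.single (D.smooth S B) ((-1) ^ S.card * r)) =
        ∑ A ∈ (D.crossings \ S).powerset, Finsupp.single (D.stateClass (B ∪ A))
          ((-1) ^ D.crossings.card * φ (D.stateTrivial (B ∪ A)) * r) := by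
    intro S hS B hB r
    rw [Finset.mem_powerset] at hS hB
    rw [project, Finsupp.linearCombination_single, Finset.smul_sum]
    refine Finset.sum_congr rfl fun A hA => ?_
    rw [Finset.mem_powerset] at hA
    have e : (D.smooth S B).state A = D.state (B ∪ A) := by
      refine Diagram.smooth_smoothSet D fun c _ => ?_
      have h1 := @hB c
      have h2 := @hA c
      simp only [Finset.mem_sdiff, Finset.mem_union] at *
      tauto
    rw [Diagram.stateClass_congr e, Diagram.stateTrivial_congr e, Finsupp.smul_single, smul_eq_mul]
    congr 1
    -- The sign from `project` counts the crossings left after smoothing and the sign from `chi`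
    -- counts those in `S`; together they count all of them.
    have hc : (D.smooth S B).crossings.card + S.card = D.crossings.card :=
      Finset.card_sdiff_add_card_eq_card hS
    rw [← hc, pow_add]
    ring
  rw [chi_single, map_sum]
  have h' : ∀ S ∈ D.crossings.powerset,
      project φ (∑ B ∈ S.powerset, Finsupp.single (D.smooth S B) ((-1) ^ S.card *
          P.coeff (Finsupp.single 0 B.card + Finsupp.single 1 (S \ B).card))) =
        ∑ A ∈ D.crossings.powerset, Finsupp.single (D.stateClass A)
          ((-1) ^ D.crossings.card * φ (D.stateTrivial A) *
            P.coeff (Finsupp.single 0 (S ∩ A).card + Finsupp.single 1 (S \ A).card)) := by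
    intro S hS
    rw [map_sum, Finset.sum_congr rfl fun B hB => h S hS B hB _,
      sum_powerset_states (Finset.mem_powerset.1 hS) fun B A => Finsupp.single (D.stateClass A)
          ((-1) ^ D.crossings.card * φ (D.stateTrivial A) *
            P.coeff (Finsupp.single 0 B.card + Finsupp.single 1 (S \ B).card))]
    simp only [Finset.sdiff_inter_self_left]
  rw [Finset.sum_congr rfl h', Finset.sum_comm]
  refine Finset.sum_congr rfl fun A _ => ?_
  rw [Finset.mul_sum, Finsupp.single_finsetSum]

end Resolution

/-! ### The expansion of the bracket -/

section Expansion

variable (k : Type v) [CommRing k] [Algebra ℚ k]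

/-! ### The substitution `t = e^h` and base change from `ℚ`. -/

theorem expHom_T_one : expHom k (LaurentPolynomial.T 1) = PowerSeries.exp k := by
  simp [expHom, expUnit]

theorem expHom_T_neg_one :
    expHom k (LaurentPolynomial.T (-1)) = evalNegHom (PowerSeries.exp k) := by
  simp [expHom, expUnit]

theorem expHom_loopValue : expHom k (loopValue k) =
    -PowerSeries.exp k ^ 2 - evalNegHom (PowerSeries.exp k) ^ 2 := by
  have h2 : (LaurentPolynomial.T 2 : k[T;T⁻¹]) = LaurentPolynomial.T 1 ^ 2 := by
    rw [LaurentPolynomial.T_pow]; norm_num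
  have h2' : (LaurentPolynomial.T (-2) : k[T;T⁻¹]) = LaurentPolynomial.T (-1) ^ 2 := by
    rw [LaurentPolynomial.T_pow]; norm_num
  rw [loopValue, h2, h2', map_sub, map_neg, map_pow, map_pow, expHom_T_one, expHom_T_neg_one]

theorem map_evalNegHom_exp : PowerSeries.map (algebraMap ℚ k)
    (evalNegHom (PowerSeries.exp ℚ)) = evalNegHom (PowerSeries.exp k) := by
  ext n
  simp [evalNegHom, PowerSeries.coeff_rescale, PowerSeries.coeff_exp]

/-! ### Parity of the loop value and the coefficient of a single state. -/

theorem evalNegHom_evalNegHom (f : PowerSeries k) : evalNegHom (evalNegHom f) = f := by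
  ext n
  rw [evalNegHom, PowerSeries.coeff_rescale, PowerSeries.coeff_rescale, ← mul_assoc, ← mul_pow]
  simp

/-- The loop value is symmetric under `t ↔ t⁻¹`, so its expansion is invariant under `h ↦ -h`. This
is why only the even-order coefficients `φ_j` occur. -/
theorem coeff_expHom_loopValue_pow_of_odd {n : ℕ} (hn : Odd n) (i : ℕ) :
    PowerSeries.coeff n (expHom ℚ (loopValue ℚ ^ i)) = 0 := by
  have h : evalNegHom (expHom ℚ (loopValue ℚ ^ i)) = expHom ℚ (loopValue ℚ ^ i) := by
    rw [map_pow, map_pow, expHom_loopValue, map_sub, map_neg, map_pow, map_pow,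
      evalNegHom_evalNegHom]
    ring
  have h1 := congrArg (PowerSeries.coeff n) h
  rw [evalNegHom, PowerSeries.coeff_rescale, hn.neg_one_pow] at h1
  linarith

theorem coeff_mul_of_even {R : Type*} [CommSemiring R] (f g : PowerSeries R)
    (h : ∀ n, Odd n → PowerSeries.coeff n f = 0) (n : ℕ) :
    PowerSeries.coeff n (f * g) = ∑ j ∈ Finset.range (n / 2 + 1),
      PowerSeries.coeff (2 * j) f * PowerSeries.coeff (n - 2 * j) g := by
  rw [PowerSeries.coeff_mul, Finset.Nat.sum_antidiagonal_eq_sum_range_succ_mk]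
  symm
  -- In the Cauchy product only the even indices `m = 2j` contribute, and `m ≤ n` amounts to `j ≤ n
  -- / 2`.
  refine Finset.sum_of_injOn (fun j => 2 * j) ?_ ?_ ?_ ?_
  · intro a _ b _ hab
    simpa using hab
  · intro j hj
    simp only [Finset.coe_range, Set.mem_Iio] at hj ⊢
    omega
  · intro m hm hm'
    rcases Nat.even_or_odd' m with ⟨j, rfl | rfl⟩
    · refine absurd ⟨j, ?_, rfl⟩ hm'
      simp only [Finset.mem_range, Finset.coe_range, Set.mem_Iio] at hm ⊢
      omega
    · rw [h _ ⟨j, rfl⟩, zero_mul]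
  · intro j _
    rfl

/-- Separates the sign, the even loop factor and the exponential of the markers; the Cauchy product
of the last two yields the sum over `j`. -/
theorem coeff_expHom_state (n q p m : ℕ) :
    PowerSeries.coeff n (expHom k ((-LaurentPolynomial.T 1) ^ q *
        (-LaurentPolynomial.T (-1)) ^ p * loopValue k ^ m)) =
      ∑ j ∈ Finset.range (n / 2 + 1), (-1) ^ (q + p) * loopCoeff k j m *
        algebraMap ℚ k (PowerSeries.coeff (n - 2 * j)
          (evalNegHom (PowerSeries.exp ℚ) ^ p * PowerSeries.exp ℚ ^ q)) := by
  -- The series is the image of a rational one, so its coefficients are images of the rational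
  -- numbers defining `loopCoeff` and the weights.
  have e : expHom k ((-LaurentPolynomial.T 1) ^ q *
        (-LaurentPolynomial.T (-1)) ^ p * loopValue k ^ m) =
      PowerSeries.map (algebraMap ℚ k) ((-1) ^ (q + p) * (expHom ℚ (loopValue ℚ ^ m) *
        (evalNegHom (PowerSeries.exp ℚ) ^ p * PowerSeries.exp ℚ ^ q))) := by
    simp only [map_mul, map_pow, map_neg, map_one, map_sub, expHom_loopValue, expHom_T_one,
      expHom_T_neg_one, map_evalNegHom_exp, PowerSeries.map_exp]
    rw [neg_pow (PowerSeries.exp k), neg_pow (evalNegHom (PowerSeries.exp k))]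
    ring
  have s : ((-1) ^ (q + p) : PowerSeries ℚ) = PowerSeries.C ((-1) ^ (q + p)) := by simp
  rw [e, PowerSeries.coeff_map, s, PowerSeries.coeff_C_mul, coeff_mul_of_even _ _
    fun n hn => coeff_expHom_loopValue_pow_of_odd hn m, map_mul, map_sum, Finset.mul_sum]
  refine Finset.sum_congr rfl fun j _ => ?_
  rw [map_mul, loopCoeff]
  simp [mul_assoc]

/-! ### Comparison of the bracket and the resolution sum, state by state. -/

variable {F : Type u} [TopologicalSpace F] [ChartedSpace (EuclideanHalfSpace 2) F] [T2Space F]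
  [CompactSpace F]

theorem curveExpansion_skeinClass (D : Diagram F) :
    curveExpansion k (skeinClass k D) = bracketDiagram k D := by
  rw [curveExpansion, skeinClass, Submodule.liftQ_apply, bracket,
    Finsupp.linearCombination_single, one_smul]

open Classical in
theorem bracketCoeff_eq (n : ℕ) (D : Diagram F) :
    bracketCoeff k n D = ∑ A ∈ D.crossings.powerset, Finsupp.single (D.stateClass A)
      (PowerSeries.coeff n (expHom k ((-LaurentPolynomial.T 1) ^ (D.crossings \ A).card *
        (-LaurentPolynomial.T (-1)) ^ A.card * loopValue k ^ D.stateTrivial A))) := by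
  -- Taking the coefficient of `h^n` is additive, so it passes through the state sum.
  set f : k[T;T⁻¹] →+ k :=
    (PowerSeries.coeff (R := k) n).toAddMonoidHom.comp (expHom k).toAddMonoidHom with hf
  have h : ∀ x : CurveClass F →₀ k[T;T⁻¹],
      hCoeff k n x = Finsupp.mapRange.addMonoidHom f x := fun x => rfl
  rw [bracketCoeff, curveExpansion_skeinClass, h, bracketDiagram, map_sum]
  refine Finset.sum_congr rfl fun A _ => ?_
  rw [Finsupp.mapRange.addMonoidHom_apply, Finsupp.mapRange_single]
  rfl

/-- The order `n` term of the bracket as a sum of projected resolutions. -/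
theorem bracketCoeff_eq_resolutionSum (n : ℕ) (D : Diagram F) :
    bracketCoeff k n D = resolutionSum k resolutionPoly n D := by
  classical
  rw [bracketCoeff_eq, resolutionSum]
  simp only [project_chi_single]
  -- With the full state `A` outermost, the identity reduces to one scalar equation for each `A`.
  rw [Finset.sum_comm]
  refine Finset.sum_congr rfl fun A hA => ?_
  rw [← Finsupp.single_finsetSum, coeff_expHom_state]
  congr 1
  refine Finset.sum_congr rfl fun j _ => ?_
  rw [Finset.mem_powerset] at hA
  rw [Finset.card_sdiff_add_card_eq_card hA, ← sum_resolutionWeight _ _ _ hA, map_sum]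
  congr 1
  refine Finset.sum_congr rfl fun S _ => ?_
  rw [MvPolynomial.coeff_map, coeff_resolutionPoly]
  simp

end Expansion

end KauffmanStar

theorem mainTheorem4 :
    ∃ P : ℕ → MvPolynomial (Fin 2) ℚ,
      (∀ n, (P n).totalDegree = n ∧
        MvPolynomial.homogeneousComponent n (P n) =
          ∑ i ∈ Finset.range (n + 1),
            (-1) ^ i * MvPolynomial.X 0 ^ i * MvPolynomial.X 1 ^ (n - i)) ∧
      (∀ n, 1 < n → ¬ (P n).IsHomogeneous n) ∧
      ∀ (F : Type u) [TopologicalSpace F] [T2Space F] [CompactSpace F] [ConnectedSpace F]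
        [ChartedSpace (EuclideanHalfSpace 2) F] [IsManifold (𝓡∂ 2) ∞ F] [IsOriented F]
        (k : Type v) [CommRing k] [Algebra ℚ k],
        (∀ (D : Diagram F) (n : ℕ), bracketCoeff k n D = resolutionSum k P n D) ∧
        ∀ α β : CurveClass F, α.IsLoop → β.IsLoop →
          ∀ (D : StackedDiagram α β) (n : ℕ),
            starCoeff k n D = resolutionSum k P n D.toDiagram := by
  refine ⟨resolutionPoly, fun n => ⟨totalDegree_resolutionPoly n,
    homogeneousComponent_resolutionPoly n⟩, fun n hn => not_isHomogeneous_resolutionPoly hn, ?_⟩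
  intro F _ _ _ _ _ _ _ k _ _
  exact ⟨fun D n => bracketCoeff_eq_resolutionSum k n D,
    -- `starCoeff` unfolds to `bracketCoeff` of the underlying diagram, so the second claim is an
    -- instance of the first.
    fun α β _ _ D n => bracketCoeff_eq_resolutionSum k n D.toDiagram⟩
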